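/- Let $\mathsf{PV}$ be a non-empty set of propositional variables and let $\mathcal L$ be the set of formulas $\varphi ::= p \mid \varphi\wedge\varphi \mid \neg\varphi \mid \square\varphi \mid \bigcirc\varphi$ ($p\in\mathsf{PV}$), with $\varphi\to\psi := \neg(\varphi\wedge\neg\psi)$ and $\varphi\leftrightarrow\psi:=(\varphi\to\psi)\wedge(\psi\to\varphi)$. All logics below are axiomatised by all propositional tautologies (in the language $\mathcal L$), $\square(\varphi\to\psi)\to(\square\varphi\to\square\psi)$, $\neg\bigcirc\varphi\leftrightarrow\bigcirc\neg\varphi$, $\bigcirc(\varphi\wedge\psi)\leftrightarrow\bigcirc\varphi\wedge\bigcirc\psi$, the rules of modus ponens and of necessitation for $\square$ and for $\bigcirc$, together with the following schemata, where $\mathrm{w4} := \varphi\wedge\square\varphi\to\square\square\varphi$, $\mathrm 4 := \square\varphi\to\square\square\varphi$, $\mathrm L := \square(\square\varphi\to\varphi)\to\square\varphi$, $\mathrm C := \bigcirc\varphi\wedge\bigcirc\square\varphi\to\square\bigcirc\varphi$, $\mathrm H := \square\bigcirc\varphi\leftrightarrow\bigcirc\square\varphi$: $\mathbf{wK4C}$: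 $\mathrm{w4},\mathrm C$; $\mathbf{K4C}$: $\mathrm 4,\mathrm C$; $\mathbf{GLC}$: $\mathrm 4,\mathrm L,\mathrm C$; $\mathbf{wK4H}$: $\mathrm{w4},\mathrm H$; $\mathbf{K4H}$: $\mathrm 4,\mathrm H$; $\mathbf{GLH}$: $\mathrm 4,\mathrm L,\mathrm H$. A dynamic Kripke frame $\langle W,\sqsubset,g\rangle$ is a set $W$ with a binary relation $\sqsubset$ and a function $g\colon W\to W$ that is weakly monotonic: $w\sqsubset v$ implies $g(w)=g(v)$ or $g(w)\sqsubset g(v)$. It is a dynamic $\mathbf{wK4}$ frame if $\sqsubset$ is weakly transitive ($w\sqsubset v\sqsubset u$ implies $w=u$ or $w\sqsubset u$), a dynamic $\mathbf{K4}$ frame if $\sqsubset$ is transitive, and a dynamic $\mathbf{GL}$ frame if $\sqsubset$ is transitive and converse well-founded. It is invertible if $g$ is a bijection and $w\sqsubset v\iff g(w)\sqsubset g(v)$ for all $w,v$. On frames, $\square\varphi$ is true at $w$ iff $\varphi$ is true at all $v$ with $w\sqsubset v$, and $\bigcirc\varphi$ is true at $w$ iff $\varphi$ is true at $g(w)$.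 A dynamic topological system (DTS) $\langle X,\tau,f\rangle$ is a topological space with a continuous function $f\colon X\to X$; it is invertible if $f$ is a homeomorphism. In the $d$-semantics, $\|\square\varphi\| = X\setminus d(X\setminus\|\varphi\|)$ and $\|\bigcirc\varphi\|=f^{-1}(\|\varphi\|)$, where $d(A)$ is the Cantor derivative, the set of $x$ in the closure of $A\setminus\{x\}$. A space is $T_D$ if every singleton is the intersection of an open set and a closed set, and scattered if $S\subseteq d(S)$ implies $S=\varnothing$ for every $S\subseteq X$. A formula is valid on a frame or DTS if it is true at every point under every valuation. A logic is sound and complete for a class of frames or DTSs if, for every $\varphi\in\mathcal L$, $\varphi$ is derivable in the logic iff $\varphi$ is valid on every member of the class. **Theorem.** 1. $\mathbf{wK4C}$ is sound and complete for the class of finite dynamic $\mathbf{wK4}$ frames, and for the class of finite DTSs with respect to $d$-semantics. 2. $\mathbf{K4C}$ is sound and complete for the class of finite dynamic $\mathbf{K4}$ frames, and for the class of DTSs based on a $T_D$ space with respect to $d$-semantics. 3. $\mathbf{GLC}$ is sound and complete for the class of finite dynamic $\mathbf{GL}$ frames, and for the class of finite DTSs based on a scattered space with respect to $d$-semantics.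 The same six statements hold with $\mathbf{wK4H},\mathbf{K4H},\mathbf{GLH}$ in place of $\mathbf{wK4C},\mathbf{K4C},\mathbf{GLC}$ and with the classes of frames and of DTSs restricted to their invertible members. Consequently each of the six logics has the finite Kripke model property: every formula that is not derivable in the logic fails to be valid on some finite dynamic Kripke frame that validates all theorems of the logic. -/

import Mathlib

universe u v

namespace CantorDynamic

/-! ### Syntax -/

/-- Formulas of the language with `□` and `○` over the propositional variables `PV`. -/
inductive Formula (PV : Type u) : Type u
  | var : PV → Formula PV
  | and : Formula PV → Formula PV → Formula PV
  | neg : Formula PV → Formula PV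
  | box : Formula PV → Formula PV
  | next : Formula PV → Formula PV

namespace Formula

variable {PV : Type u}

/-- `φ → ψ`, defined as `¬(φ ∧ ¬ψ)`. -/
def imp (φ ψ : Formula PV) : Formula PV := neg (and φ (neg ψ))

/-- `φ ↔ ψ`, defined as `(φ → ψ) ∧ (ψ → φ)`. -/
def iff (φ ψ : Formula PV) : Formula PV := and (imp φ ψ) (imp ψ φ)

/-- Propositional evaluation: variables and formulas that begin with a modality are treated
as propositional atoms, whose truth values are given by `a`. -/
def propEval (a : Formula PV → Prop) : Formula PV → Prop
  | .var p => a (var p)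
  | .and φ ψ => propEval a φ ∧ propEval a ψ
  | .neg φ => ¬ propEval a φ
  | .box φ => a (box φ)
  | .next φ => a (next φ)

/-- Propositional tautologies (in the modal language). -/
def IsTautology (φ : Formula PV) : Prop := ∀ a : Formula PV → Prop, propEval a φ

end Formula

open Formula

/-! ### Axiom schemata and logics -/

/-- `φ ∧ □φ → □□φ`. -/
def axiomW4 (PV : Type u) : Set (Formula PV) :=
  {χ | ∃ φ, χ = imp (and φ (box φ)) (box (box φ))}

/-- `□φ → □□φ`. -/
def axiom4 (PV : Type u) : Set (Formula PV) :=
  {χ | ∃ φ, χ = imp (box φ) (box (box φ))}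

/-- `□(□φ → φ) → □φ`. -/
def axiomL (PV : Type u) : Set (Formula PV) :=
  {χ | ∃ φ, χ = imp (box (imp (box φ) φ)) (box φ)}

/-- `○φ ∧ ○□φ → □○φ`. -/
def axiomC (PV : Type u) : Set (Formula PV) :=
  {χ | ∃ φ, χ = imp (and (next φ) (next (box φ))) (box (next φ))}

/-- `□○φ ↔ ○□φ`. -/
def axiomH (PV : Type u) : Set (Formula PV) :=
  {χ | ∃ φ, χ = iff (box (next φ)) (next (box φ))}

/-- Derivability from the tautologies, `K`, the two axioms for `○`, and the extra axioms `Ax`,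
by modus ponens and necessitation for `□` and for `○`. -/
inductive Derivable {PV : Type u} (Ax : Set (Formula PV)) : Formula PV → Prop
  | ax {φ : Formula PV} : φ ∈ Ax → Derivable Ax φ
  | taut {φ : Formula PV} : IsTautology φ → Derivable Ax φ
  | k (φ ψ : Formula PV) : Derivable Ax (imp (box (imp φ ψ)) (imp (box φ) (box ψ)))
  | nextNeg (φ : Formula PV) : Derivable Ax (iff (neg (next φ)) (next (neg φ)))
  | nextAnd (φ ψ : Formula PV) :
      Derivable Ax (iff (next (and φ ψ)) (and (next φ) (next ψ)))
  | mp {φ ψ : Formula PV} : Derivable Ax φ → Derivable Ax (imp φ ψ) → Derivable Ax ψ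
  | necBox {φ : Formula PV} : Derivable Ax φ → Derivable Ax (box φ)
  | necNext {φ : Formula PV} : Derivable Ax φ → Derivable Ax (next φ)

def wK4C (PV : Type u) : Set (Formula PV) := {φ | Derivable (axiomW4 PV ∪ axiomC PV) φ}

def K4C (PV : Type u) : Set (Formula PV) := {φ | Derivable (axiom4 PV ∪ axiomC PV) φ}

def GLC (PV : Type u) : Set (Formula PV) :=
  {φ | Derivable (axiom4 PV ∪ axiomL PV ∪ axiomC PV) φ}

def wK4H (PV : Type u) : Set (Formula PV) := {φ | Derivable (axiomW4 PV ∪ axiomH PV) φ}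

def K4H (PV : Type u) : Set (Formula PV) := {φ | Derivable (axiom4 PV ∪ axiomH PV) φ}

def GLH (PV : Type u) : Set (Formula PV) :=
  {φ | Derivable (axiom4 PV ∪ axiomL PV ∪ axiomH PV) φ}

/-! ### Semantics -/

/-- Truth sets, for an operator `b` on subsets that interprets `□`, a function `f` that
interprets `○`, and a valuation `V`. -/
def truthSet {PV : Type u} {X : Type v} (b : Set X → Set X) (f : X → X) (V : PV → Set X) :
    Formula PV → Set X
  | .var p => V p
  | .and φ ψ => truthSet b f V φ ∩ truthSet b f V ψ
  | .neg φ => (truthSet b f V φ)ᶜ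
  | .box φ => b (truthSet b f V φ)
  | .next φ => f ⁻¹' truthSet b f V φ

/-- Dynamic Kripke frames: a binary relation with a weakly monotonic self-map. -/
structure DynamicFrame : Type (v + 1) where
  W : Type v
  rel : W → W → Prop
  map : W → W
  weaklyMonotonic : ∀ w w', rel w w' → map w = map w' ∨ rel (map w) (map w')

namespace DynamicFrame

/-- The worlds all of whose successors lie in `A`. -/
def kripkeBox (F : DynamicFrame.{v}) (A : Set F.W) : Set F.W := {w | ∀ w', F.rel w w' → w' ∈ A}

/-- A formula is valid on a frame if it is true at all worlds under all valuations. -/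
def Valid {PV : Type u} (F : DynamicFrame.{v}) (φ : Formula PV) : Prop :=
  ∀ V : PV → Set F.W, truthSet F.kripkeBox F.map V φ = Set.univ

/-- `wK4` frames: the relation is weakly transitive. -/
def IsWK4 (F : DynamicFrame.{v}) : Prop :=
  ∀ x y z, F.rel x y → F.rel y z → x = z ∨ F.rel x z

/-- `K4` frames: the relation is transitive. -/
def IsK4 (F : DynamicFrame.{v}) : Prop :=
  ∀ x y z, F.rel x y → F.rel y z → F.rel x z

/-- `GL` frames: the relation is transitive and converse well-founded. -/
def IsGL (F : DynamicFrame.{v}) : Prop :=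
  F.IsK4 ∧ WellFounded (fun x y => F.rel y x)

/-- Invertible frames: the map is an automorphism of the relation. -/
def IsInvertible (F : DynamicFrame.{v}) : Prop :=
  Function.Bijective F.map ∧ ∀ x y, F.rel x y ↔ F.rel (F.map x) (F.map y)

end DynamicFrame

/-- Dynamic topological systems. -/
structure DTS : Type (v + 1) where
  X : Type v
  [top : TopologicalSpace X]
  map : X → X
  continuous_map : Continuous map

attribute [instance] DTS.top

namespace DTS

/-- The co-derivative: the complement of the Cantor derivative of the complement. -/
def coderivative (S : DTS.{v}) (A : Set S.X) : Set S.X := (derivedSet Aᶜ)ᶜ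

/-- A formula is valid on a DTS (in the `d`-semantics) if it is true at all points under all
valuations. -/
def Valid {PV : Type u} (S : DTS.{v}) (φ : Formula PV) : Prop :=
  ∀ V : PV → Set S.X, truthSet S.coderivative S.map V φ = Set.univ

/-- `T_D` spaces: every singleton is the intersection of an open set and a closed set. -/
def IsTD (S : DTS.{v}) : Prop := ∀ x : S.X, IsLocallyClosed ({x} : Set S.X)

/-- Scattered spaces. -/
def IsScattered (S : DTS.{v}) : Prop := ∀ A : Set S.X, A ⊆ derivedSet A → A = ∅

/-- Invertible systems: the map is a homeomorphism. -/
def IsInvertible (S : DTS.{v}) : Prop := IsHomeomorph S.map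

end DTS

/-- `L` is sound and complete for the class `C` of dynamic Kripke frames. -/
def FrameSoundComplete {PV : Type u} (L : Set (Formula PV)) (C : Set DynamicFrame.{v}) : Prop :=
  (∀ φ ∈ L, ∀ F ∈ C, F.Valid φ) ∧ ∀ φ, (∀ F ∈ C, F.Valid φ) → φ ∈ L

/-- `L` is sound and complete for the class `C` of DTSs, with respect to the `d`-semantics. -/
def TopSoundComplete {PV : Type u} (L : Set (Formula PV)) (C : Set DTS.{v}) : Prop :=
  (∀ φ ∈ L, ∀ S ∈ C, S.Valid φ) ∧ ∀ φ, (∀ S ∈ C, S.Valid φ) → φ ∈ L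

/-- The finite Kripke model property: every non-theorem of `L` is refuted on a finite dynamic
frame that validates `L`. -/
def HasFiniteKripkeModelProperty {PV : Type u} (L : Set (Formula PV)) : Prop :=
  ∀ φ, φ ∉ L → ∃ F : DynamicFrame.{v}, Finite F.W ∧ (∀ ψ ∈ L, F.Valid ψ) ∧ ¬ F.Valid φ

end CantorDynamic

open CantorDynamic

namespace CantorDynamic

open Formula Set

/-! ### Soundness -/

section Soundness

variable {PV : Type u} {X : Type v} {b : Set X → Set X} {f : X → X} {V : PV → Set X}

/-! Soundness is a computation with operators on sets. For completeness, the canonical frame is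
weakly transitive by w4, transitive by 4 and weakly monotonic by C; under H its map is a p-morphism.
But it is infinite, and a finite quotient of its relation need not inherit the map. The way out is
that a formula with n nested ○ looks only n steps ahead.

For C, `exists_finite_layers` stacks finite quotients of the canonical relation, one for each step:
the map leads from a layer to the next, while boxes are evaluated inside a layer. The quotients are
provided by `HasFiniteQuotients`. Under L the canonical relation may still have reflexive points, so
the layers are then finite sets of paths, closed under witnesses for failing boxes; Löb's principle
keeps these sets finite (`exists_finite_layers_of_loeb`).

For H, a finite selection of canonical worlds, faithful to all ○^i ψ with i ≤ n, is copied n + 1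
times and the copies are permuted cyclically. The point (q, i) stands for the i-fold image of q, and
the evaluation never runs past the last copy (`mem_truth_cyclic`).

For the d-semantics, the upward closed sets of an irreflexive weakly transitive frame form a space
whose co-derivative is the Kripke box. Reflexive points are first removed by passing to a p-morphic
preimage: pairs of points that see each other for wK4, paths for K4C, a product with ℕ for K4H. GL
frames have no reflexive points. -/

theorem mem_truthSet_imp {φ ψ : Formula PV} {x : X} :
    x ∈ truthSet b f V (imp φ ψ) ↔ (x ∈ truthSet b f V φ → x ∈ truthSet b f V ψ) := by
  simp [imp, truthSet]

theorem mem_truthSet_iff {φ ψ : Formula PV} {x : X} :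
    x ∈ truthSet b f V (iff φ ψ) ↔ (x ∈ truthSet b f V φ ↔ x ∈ truthSet b f V ψ) := by
  simp only [Formula.iff, truthSet, mem_inter_iff, mem_truthSet_imp]
  tauto

/-- Operators on sets that interpret a normal modality. -/
structure IsNormalOperator (b : Set X → Set X) : Prop where
  univ : b univ = univ
  inter : ∀ A B, b (A ∩ B) = b A ∩ b B

theorem IsNormalOperator.mono (hb : IsNormalOperator b) {A B : Set X} (h : A ⊆ B) :
    b A ⊆ b B := by
  have := hb.inter A B
  rw [inter_eq_left.2 h] at this
  rw [this]
  exact inter_subset_right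

theorem propEval_truthSet (φ : Formula PV) (x : X) :
    propEval (fun ψ => x ∈ truthSet b f V ψ) φ ↔ x ∈ truthSet b f V φ := by
  induction φ with
  | var p => rfl
  | and φ ψ h₁ h₂ => simp only [propEval, h₁, h₂, truthSet, mem_inter_iff]
  | neg φ h => simp only [propEval, h, truthSet, mem_compl_iff]
  | box φ => rfl
  | next φ => rfl

theorem Derivable.sound (hb : IsNormalOperator b) {Ax : Set (Formula PV)}
    (hAx : ∀ χ ∈ Ax, ∀ x, x ∈ truthSet b f V χ) {φ : Formula PV} (h : Derivable Ax φ) (x : X) :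
    x ∈ truthSet b f V φ := by
  induction h generalizing x with
  | ax h => exact hAx _ h x
  | taut h => exact (propEval_truthSet _ x).1 (h _)
  | k φ ψ =>
    simp only [mem_truthSet_imp, truthSet]
    intro h₁ h₂
    have h₃ : x ∈ b (truthSet b f V (imp φ ψ) ∩ truthSet b f V φ) := by
      rw [hb.inter]; exact ⟨h₁, h₂⟩
    exact hb.mono (fun y hy => mem_truthSet_imp.1 hy.1 hy.2) h₃
  | nextNeg φ => simp [mem_truthSet_iff, truthSet]
  | nextAnd φ ψ => simp [mem_truthSet_iff, truthSet]
  | mp _ _ h₁ h₂ => exact mem_truthSet_imp.1 (h₂ x) (h₁ x)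
  | necBox _ h =>
    simp only [truthSet]
    rw [eq_univ_of_forall h, hb.univ]
    trivial
  | necNext _ h => exact h (f x)

theorem sound_axiomW4 (h : ∀ A, A ∩ b A ⊆ b (b A)) :
    ∀ χ ∈ axiomW4 PV, ∀ x, x ∈ truthSet b f V χ := by
  rintro _ ⟨φ, rfl⟩ x
  exact mem_truthSet_imp.2 fun hx => h _ hx

theorem sound_axiom4 (h : ∀ A, b A ⊆ b (b A)) :
    ∀ χ ∈ axiom4 PV, ∀ x, x ∈ truthSet b f V χ := by
  rintro _ ⟨φ, rfl⟩ x
  exact mem_truthSet_imp.2 fun hx => h _ hx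

theorem sound_axiomL (hb : IsNormalOperator b) (h : ∀ A, b ((b A)ᶜ ∪ A) ⊆ b A) :
    ∀ χ ∈ axiomL PV, ∀ x, x ∈ truthSet b f V χ := by
  rintro _ ⟨φ, rfl⟩ x
  refine mem_truthSet_imp.2 fun hx => h _ (hb.mono (fun y hy => ?_) hx)
  exact imp_iff_not_or.1 (mem_truthSet_imp.1 hy)

theorem sound_axiomC (h : ∀ A, f ⁻¹' A ∩ f ⁻¹' (b A) ⊆ b (f ⁻¹' A)) :
    ∀ χ ∈ axiomC PV, ∀ x, x ∈ truthSet b f V χ := by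
  rintro _ ⟨φ, rfl⟩ x
  exact mem_truthSet_imp.2 fun hx => h _ hx

theorem sound_axiomH (h : ∀ A, b (f ⁻¹' A) = f ⁻¹' (b A)) :
    ∀ χ ∈ axiomH PV, ∀ x, x ∈ truthSet b f V χ := by
  rintro _ ⟨φ, rfl⟩ x
  refine mem_truthSet_iff.2 ?_
  simp only [truthSet, h]

/-- Löb's principle implies transitivity. -/
theorem IsNormalOperator.four_of_loeb (hb : IsNormalOperator b)
    (h : ∀ A, b ((b A)ᶜ ∪ A) ⊆ b A) (A : Set X) : b A ⊆ b (b A) := by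
  -- Löb's principle will be applied to A ∩ b A. The required implication holds on A because b (A ∩
  -- b A) ⊆ b A.
  have h₁ : A ⊆ (b (A ∩ b A))ᶜ ∪ (A ∩ b A) := by
    intro y hy
    by_cases hy' : y ∈ b (A ∩ b A)
    · exact Or.inr ⟨hy, hb.mono inter_subset_left hy'⟩
    · exact Or.inl hy'
  exact (hb.mono h₁).trans ((h _).trans (hb.mono inter_subset_right))

end Soundness

/-! ### The box of a Kripke frame. -/

namespace DynamicFrame

variable (F : DynamicFrame.{v})

theorem isNormalOperator_kripkeBox : IsNormalOperator F.kripkeBox where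
  univ := by ext; simp [kripkeBox]
  inter A B := by
    ext x
    simp only [kripkeBox, mem_ofPred_eq, mem_inter_iff]
    exact ⟨fun h => ⟨fun y hy => (h y hy).1, fun y hy => (h y hy).2⟩,
      fun h y hy => ⟨h.1 y hy, h.2 y hy⟩⟩

variable {F}

theorem IsWK4.kripkeBox (h : F.IsWK4) (A : Set F.W) :
    A ∩ F.kripkeBox A ⊆ F.kripkeBox (F.kripkeBox A) := by
  intro x hx y hy z hz
  rcases h x y z hy hz with rfl | h'
  · exact hx.1
  · exact hx.2 z h'

theorem IsK4.kripkeBox (h : F.IsK4) (A : Set F.W) :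
    F.kripkeBox A ⊆ F.kripkeBox (F.kripkeBox A) :=
  fun x hx y hy z hz => hx z (h x y z hy hz)

/-- Well-founded induction on the successor y of x: by transitivity the successors of y are
successors of x, hence in A by induction, so y satisfies the premise □A and therefore A. -/
theorem IsGL.kripkeBox (h : F.IsGL) (A : Set F.W) :
    F.kripkeBox ((F.kripkeBox A)ᶜ ∪ A) ⊆ F.kripkeBox A := by
  intro x hx y
  induction y using h.2.induction with
  | _ y ih =>
    intro hy
    refine (hx y hy).resolve_left fun h' => h' fun z hz => ih z hz (h.1 x y z hy hz)

variable (F) in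
theorem kripkeBox_C (A : Set F.W) :
    F.map ⁻¹' A ∩ F.map ⁻¹' (F.kripkeBox A) ⊆ F.kripkeBox (F.map ⁻¹' A) := by
  intro x hx y hy
  rcases F.weaklyMonotonic x y hy with h | h
  · exact show F.map y ∈ A from h ▸ hx.1
  · exact hx.2 _ h

theorem IsInvertible.kripkeBox (h : F.IsInvertible) (A : Set F.W) :
    F.kripkeBox (F.map ⁻¹' A) = F.map ⁻¹' (F.kripkeBox A) := by
  ext x
  constructor
  · intro hx y hy
    obtain ⟨y, rfl⟩ := h.1.2 y
    exact hx y ((h.2 x y).2 hy)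
  · exact fun hx y hy => hx _ ((h.2 x y).1 hy)

end DynamicFrame

/-! ### The co-derivative of a topological space. -/

namespace DTS

variable {S : DTS.{v}}

theorem mem_coderivative {A : Set S.X} {x : S.X} :
    x ∈ S.coderivative A ↔ ∃ U, IsOpen U ∧ x ∈ U ∧ ∀ y ∈ U, y ≠ x → y ∈ A := by
  simp only [coderivative, mem_compl_iff, mem_derivedSet, accPt_iff_nhds, not_forall]
  constructor
  · rintro ⟨N, hN, h⟩
    obtain ⟨U, hU, hUo, hx⟩ := mem_nhds_iff.1 hN
    refine ⟨U, hUo, hx, fun y hy hyx => ?_⟩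
    by_contra hyA
    exact h ⟨y, ⟨hU hy, hyA⟩, hyx⟩
  · rintro ⟨U, hU, hx, h⟩
    refine ⟨U, hU.mem_nhds hx, ?_⟩
    rintro ⟨y, hy, hyx⟩
    exact hy.2 (h y hy.1 hyx)

theorem mem_coderivative_compl {A : Set S.X} {x : S.X} :
    x ∈ S.coderivative Aᶜ ↔ x ∉ derivedSet A := by
  simp [coderivative]

variable (S)

theorem isNormalOperator_coderivative : IsNormalOperator S.coderivative where
  univ := eq_univ_of_forall fun x =>
    mem_coderivative.2 ⟨univ, isOpen_univ, trivial, fun _ _ _ => trivial⟩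
  inter A B := by
    ext x
    simp only [mem_inter_iff, mem_coderivative]
    constructor
    · rintro ⟨U, hU, hx, h⟩
      exact ⟨⟨U, hU, hx, fun y hy hyx => (h y hy hyx).1⟩,
        ⟨U, hU, hx, fun y hy hyx => (h y hy hyx).2⟩⟩
    · rintro ⟨⟨U, hU, hx, h⟩, ⟨U', hU', hx', h'⟩⟩
      exact ⟨U ∩ U', hU.inter hU', ⟨hx, hx'⟩,
        fun y hy hyx => ⟨h y hy.1 hyx, h' y hy.2 hyx⟩⟩

/-- Since x itself lies in A, the neighbourhood U of x is contained in A and serves for each of its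
points. -/
theorem coderivative_w4 (A : Set S.X) :
    A ∩ S.coderivative A ⊆ S.coderivative (S.coderivative A) := by
  rintro x ⟨hxA, hx⟩
  obtain ⟨U, hU, hxU, h⟩ := mem_coderivative.1 hx
  refine mem_coderivative.2 ⟨U, hU, hxU, fun y hy _ => mem_coderivative.2 ⟨U, hU, hy, ?_⟩⟩
  intro z hz _
  by_cases hzx : z = x
  · exact hzx ▸ hxA
  · exact h z hz hzx

theorem coderivative_C (A : Set S.X) :
    S.map ⁻¹' A ∩ S.map ⁻¹' (S.coderivative A) ⊆ S.coderivative (S.map ⁻¹' A) := by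
  rintro x ⟨hxA, hx⟩
  obtain ⟨U, hU, hxU, h⟩ := mem_coderivative.1 hx
  refine mem_coderivative.2 ⟨S.map ⁻¹' U, hU.preimage S.continuous_map, hxU, ?_⟩
  intro y hy _
  by_cases hyx : S.map y = S.map x
  · exact show S.map y ∈ A from hyx ▸ hxA
  · exact h _ hy hyx

variable {S}

/-- Here x may lie outside A, so the neighbourhoods of the points near x must avoid x. If {x} = O ∩
C, then every other point of O lies in the open set Cᶜ, which misses x. -/
theorem IsTD.coderivative (hS : S.IsTD) (A : Set S.X) :
    S.coderivative A ⊆ S.coderivative (S.coderivative A) := by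
  intro x hx
  obtain ⟨U, hU, hxU, h⟩ := mem_coderivative.1 hx
  obtain ⟨O, C, hO, hC, hOC⟩ := hS x
  have hxO : x ∈ O ∩ C := hOC ▸ mem_singleton x
  refine mem_coderivative.2 ⟨U ∩ O, hU.inter hO, ⟨hxU, hxO.1⟩, fun y hy hyx => ?_⟩
  have hyC : y ∉ C := fun hyC => hyx (show y ∈ ({x} : Set S.X) from hOC ▸ ⟨hy.2, hyC⟩)
  refine mem_coderivative.2 ⟨U ∩ Cᶜ, hU.inter hC.isOpen_compl, ⟨hy.1, hyC⟩, fun z hz _ => ?_⟩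
  exact h z hz.1 fun hzx => hz.2 (hzx ▸ hxO.2)

/-- If the principle failed at x, then every point of `insert x (U \ A)` would be outside the
co-derivative of A, hence a limit point of U \ A. This nonempty set would be contained in its
derived set. -/
theorem IsScattered.coderivative (hS : S.IsScattered) (A : Set S.X) :
    S.coderivative ((S.coderivative A)ᶜ ∪ A) ⊆ S.coderivative A := by
  intro x hx
  obtain ⟨U, hU, hxU, h⟩ := mem_coderivative.1 hx
  by_contra hxA
  have key : insert x (U \ A) = ∅ := by
    refine hS _ fun y hy => ?_
    have hyU : y ∈ U := hy.elim (fun h => h ▸ hxU) fun h => h.1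
    have hyA : y ∉ S.coderivative A := by
      rcases hy with rfl | hy
      · exact hxA
      · by_cases hyx : y = x
        · exact hyx ▸ hxA
        · exact (h y hy.1 hyx).resolve_right hy.2
    by_contra hyd
    obtain ⟨O, hO, hyO, h'⟩ := mem_coderivative.1 (mem_coderivative_compl.2 hyd)
    refine hyA (mem_coderivative.2 ⟨O ∩ U, hO.inter hU, ⟨hyO, hyU⟩, fun z hz hzy => ?_⟩)
    by_contra hzA
    exact h' z hz.1 hzy (Or.inr ⟨hz.2, hzA⟩)
  exact (key ▸ mem_insert x (U \ A) : x ∈ (∅ : Set S.X))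

theorem IsInvertible.coderivative (hS : S.IsInvertible) (A : Set S.X) :
    S.coderivative (S.map ⁻¹' A) = S.map ⁻¹' (S.coderivative A) := by
  ext x
  simp only [mem_preimage, mem_coderivative]
  constructor
  · rintro ⟨U, hU, hx, h⟩
    refine ⟨S.map '' U, hS.isOpenMap U hU, ⟨x, hx, rfl⟩, ?_⟩
    rintro _ ⟨y, hy, rfl⟩ hyx
    exact h y hy fun h => hyx (h ▸ rfl)
  · rintro ⟨U, hU, hx, h⟩
    exact ⟨S.map ⁻¹' U, hU.preimage S.continuous_map, hx,
      fun y hy hyx => h _ hy fun h' => hyx (hS.bijective.1 h')⟩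

end DTS

/-! ### The canonical model -/

section Canonical

variable {PV : Type u} {Ax : Set (Formula PV)}

/-- Sets of formulas that contain the logic and are closed under modus ponens. -/
structure IsTheory (Ax : Set (Formula PV)) (T : Set (Formula PV)) : Prop where
  derivable : ∀ {φ}, Derivable Ax φ → φ ∈ T
  mp : ∀ {φ ψ}, φ ∈ T → imp φ ψ ∈ T → ψ ∈ T

/-- Theories that contain exactly one of `φ` and `¬φ`, for every `φ`. -/
structure World (Ax : Set (Formula PV)) : Type u where
  carrier : Set (Formula PV)
  isTheory : IsTheory Ax carrier
  mem_neg : ∀ {φ}, neg φ ∈ carrier ↔ φ ∉ carrier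

theorem IsTheory.taut {T : Set (Formula PV)} (hT : IsTheory Ax T) {φ : Formula PV}
    (h : IsTautology φ) : φ ∈ T :=
  hT.derivable (.taut h)

theorem IsTheory.mp_taut {T : Set (Formula PV)} (hT : IsTheory Ax T) {φ ψ : Formula PV}
    (hφ : φ ∈ T) (h : IsTautology (imp φ ψ)) : ψ ∈ T :=
  hT.mp hφ (hT.taut h)

theorem IsTheory.mp_taut₂ {T : Set (Formula PV)} (hT : IsTheory Ax T) {φ ψ χ : Formula PV}
    (hφ : φ ∈ T) (hψ : ψ ∈ T) (h : IsTautology (imp φ (imp ψ χ))) : χ ∈ T :=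
  hT.mp hψ (hT.mp_taut hφ h)

theorem propEval_imp (a : Formula PV → Prop) (φ ψ : Formula PV) :
    propEval a (imp φ ψ) ↔ (propEval a φ → propEval a ψ) := by
  simp [imp, propEval]

/-- The theory obtained by adding an assumption. -/
theorem IsTheory.adjoin {T : Set (Formula PV)} (hT : IsTheory Ax T) (ψ : Formula PV) :
    IsTheory Ax {χ | imp ψ χ ∈ T} where
  derivable h := hT.mp_taut (hT.derivable h) fun a => by simp only [propEval_imp]; tauto
  mp h₁ h₂ := hT.mp_taut₂ h₁ h₂ fun a => by simp only [propEval_imp]; tauto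

/-- Lindenbaum's lemma. -/
theorem IsTheory.exists_world {T : Set (Formula PV)} (hT : IsTheory Ax T) {φ : Formula PV}
    (hφ : φ ∉ T) : ∃ w : World Ax, T ⊆ w.carrier ∧ φ ∉ w.carrier := by
  obtain ⟨T', hTT', hmax⟩ := zorn_subset_nonempty {T | IsTheory Ax T ∧ φ ∉ T} (by
    intro c hc hchain hne
    refine ⟨⋃₀ c, ⟨⟨?_, ?_⟩, ?_⟩, fun s hs => subset_sUnion_of_mem hs⟩
    · intro ψ hψ
      obtain ⟨s, hs⟩ := hne
      exact ⟨s, hs, (hc hs).1.derivable hψ⟩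
    · rintro ψ χ ⟨s, hs, hψ⟩ ⟨t, ht, hχ⟩
      rcases hchain.total hs ht with hst | hst
      · exact ⟨t, ht, (hc ht).1.mp (hst hψ) hχ⟩
      · exact ⟨s, hs, (hc hs).1.mp hψ (hst hχ)⟩
    · rintro ⟨s, hs, h⟩
      exact (hc hs).2 h) T ⟨hT, hφ⟩
  have hT' := hmax.prop.1
  -- The formula φ plays the role of falsum: if ψ did not imply φ in T', adjoining ψ would give a
  -- larger theory without φ.
  have key : ∀ ψ, ψ ∉ T' → imp ψ φ ∈ T' := by
    intro ψ hψ
    by_contra h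
    refine hψ (hmax.le_of_ge (y := {χ | imp ψ χ ∈ T'}) ⟨hT'.adjoin ψ, h⟩ ?_ ?_)
    · exact fun χ hχ => hT'.mp_taut hχ fun a => by simp only [propEval_imp]; tauto
    · exact hT'.taut fun a => by simp only [propEval_imp]; tauto
  refine ⟨⟨T', hT', fun {ψ} => ⟨fun h₁ h₂ => ?_, fun h => ?_⟩⟩, hTT', hmax.prop.2⟩
  · exact hmax.prop.2 (hT'.mp_taut₂ h₁ h₂ fun a => by simp only [propEval_imp, propEval]; tauto)
  · by_contra h'
    exact hmax.prop.2 (hT'.mp_taut₂ (key _ h) (key _ h')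
      fun a => by simp only [propEval_imp, propEval]; tauto)

theorem isTheory_setOf_derivable : IsTheory Ax {φ | Derivable Ax φ} :=
  ⟨fun h => h, fun h₁ h₂ => h₁.mp h₂⟩

namespace World

instance : Membership (Formula PV) (World Ax) := ⟨fun w φ => φ ∈ w.carrier⟩

theorem neg_mem {w : World Ax} {φ : Formula PV} : neg φ ∈ w ↔ φ ∉ w := w.mem_neg

theorem mp {w : World Ax} {φ ψ : Formula PV} (h : imp φ ψ ∈ w) (hφ : φ ∈ w) : ψ ∈ w :=
  w.isTheory.mp hφ h

theorem mem_of_derivable (w : World Ax) {φ : Formula PV} (h : Derivable Ax φ) : φ ∈ w :=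
  w.isTheory.derivable h

theorem and_mem {w : World Ax} {φ ψ : Formula PV} : and φ ψ ∈ w ↔ φ ∈ w ∧ ψ ∈ w := by
  refine ⟨fun h => ⟨w.isTheory.mp_taut h ?_, w.isTheory.mp_taut h ?_⟩,
    fun h => w.isTheory.mp_taut₂ h.1 h.2 ?_⟩ <;>
  · intro a
    simp only [propEval_imp, propEval]
    tauto

theorem imp_mem {w : World Ax} {φ ψ : Formula PV} : imp φ ψ ∈ w ↔ (φ ∈ w → ψ ∈ w) := by
  simp [imp, neg_mem, and_mem]

theorem iff_mem {w : World Ax} {φ ψ : Formula PV} : iff φ ψ ∈ w ↔ (φ ∈ w ↔ ψ ∈ w) := by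
  simp only [Formula.iff, imp_mem, and_mem]
  tauto

theorem eq_of_subset {w v : World Ax} (h : ∀ φ, φ ∈ w → φ ∈ v) : w = v := by
  have : w.carrier = v.carrier := by
    refine Subset.antisymm h fun φ hφ => ?_
    by_contra h'
    exact v.mem_neg.1 (h _ (w.mem_neg.2 h')) hφ
  cases w; cases v; cases this; rfl

/-- The canonical accessibility relation. -/
def rel (w v : World Ax) : Prop := ∀ φ, box φ ∈ w → φ ∈ v

theorem next_neg_mem {w : World Ax} {φ : Formula PV} : next (neg φ) ∈ w ↔ next φ ∉ w := by
  have := w.mem_of_derivable (.nextNeg φ)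
  rw [iff_mem, neg_mem] at this
  exact this.symm

theorem next_and_mem {w : World Ax} {φ ψ : Formula PV} :
    next (and φ ψ) ∈ w ↔ next φ ∈ w ∧ next ψ ∈ w := by
  have := w.mem_of_derivable (.nextAnd φ ψ)
  rwa [iff_mem, and_mem] at this

/-- The canonical map. -/
def map (w : World Ax) : World Ax where
  carrier := {φ | next φ ∈ w}
  isTheory :=
    { derivable := fun h => w.mem_of_derivable h.necNext
      mp := fun {φ ψ} h₁ h₂ => by
        have h₃ : next (neg (and φ (neg ψ))) ∈ w := h₂
        rw [next_neg_mem, next_and_mem, next_neg_mem] at h₃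
        by_contra h
        exact h₃ ⟨h₁, h⟩ }
  mem_neg := next_neg_mem

theorem mem_map {w : World Ax} {φ : Formula PV} : φ ∈ w.map ↔ next φ ∈ w := Iff.rfl

theorem box_mp {w : World Ax} {φ ψ : Formula PV} (h : box (imp φ ψ) ∈ w) (hφ : box φ ∈ w) :
    box ψ ∈ w :=
  mp (mp (w.mem_of_derivable (.k φ ψ)) h) hφ

theorem box_mono {w : World Ax} {φ ψ : Formula PV} (hφ : box φ ∈ w)
    (h : IsTautology (imp φ ψ)) : box ψ ∈ w :=
  box_mp (w.mem_of_derivable (Derivable.taut h).necBox) hφ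

theorem exists_rel {w : World Ax} {φ : Formula PV} (h : box φ ∉ w) : ∃ v, w.rel v ∧ φ ∉ v := by
  have hT : IsTheory Ax {χ | box χ ∈ w} :=
    ⟨fun h => w.mem_of_derivable h.necBox, fun h₁ h₂ => box_mp h₂ h₁⟩
  obtain ⟨v, hv, hφ⟩ := hT.exists_world h
  exact ⟨v, fun χ hχ => hv hχ, hφ⟩

theorem box_mem {w : World Ax} {φ : Formula PV} : box φ ∈ w ↔ ∀ v, w.rel v → φ ∈ v := by
  refine ⟨fun h v hv => hv φ h, fun h => ?_⟩
  by_contra h'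
  obtain ⟨v, hv, hφ⟩ := exists_rel h'
  exact hφ (h v hv)

theorem exists_mem_not_mem {w v : World Ax} (h : w ≠ v) : ∃ χ, χ ∈ w ∧ χ ∉ v := by
  by_contra! h'
  exact h (eq_of_subset h')

/-- If w ≠ u, choose χ in w but not in u. For □φ in w, the formula ¬χ → φ and its box are both in w,
so w4 carries ¬χ → φ to u, where ¬χ holds. -/
theorem rel_weaklyTransitive (h : axiomW4 PV ⊆ Ax) {w v u : World Ax} (h₁ : w.rel v)
    (h₂ : v.rel u) : w = u ∨ w.rel u := by
  refine or_iff_not_imp_left.2 fun hne φ hφ => ?_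
  obtain ⟨χ, hχ, hχ'⟩ := exists_mem_not_mem hne
  have hb : box (imp (neg χ) φ) ∈ w :=
    box_mono hφ fun a => by simp only [propEval_imp]; tauto
  have hw : imp (neg χ) φ ∈ w := imp_mem.2 fun h => absurd hχ (neg_mem.1 h)
  have hbb := mp (w.mem_of_derivable (.ax (h ⟨_, rfl⟩))) (and_mem.2 ⟨hw, hb⟩)
  exact imp_mem.1 (h₂ _ (h₁ _ hbb)) (neg_mem.2 hχ')

theorem rel_trans (h : axiom4 PV ⊆ Ax) {w v u : World Ax} (h₁ : w.rel v) (h₂ : v.rel u) :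
    w.rel u :=
  fun _ hφ => h₂ _ (h₁ _ (mp (w.mem_of_derivable (.ax (h ⟨_, rfl⟩))) hφ))

/-- The argument of `rel_weaklyTransitive` with a formula χ that separates the images, and with C in
place of w4. -/
theorem map_weaklyMonotonic (h : axiomC PV ⊆ Ax) {w v : World Ax} (h₁ : w.rel v) :
    w.map = v.map ∨ w.map.rel v.map := by
  refine or_iff_not_imp_left.2 fun hne φ hφ => ?_
  obtain ⟨χ, hχ, hχ'⟩ := exists_mem_not_mem hne
  have hb : box (imp (neg χ) φ) ∈ w.map :=
    box_mono hφ fun a => by simp only [propEval_imp]; tauto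
  have hw : imp (neg χ) φ ∈ w.map := imp_mem.2 fun h => absurd hχ (neg_mem.1 h)
  have hbb := mp (w.mem_of_derivable (.ax (h ⟨_, rfl⟩))) (and_mem.2 ⟨hw, hb⟩)
  exact imp_mem.1 (mem_map.2 (h₁ _ hbb)) (neg_mem.2 hχ')

theorem box_next_mem (h : axiomH PV ⊆ Ax) {w : World Ax} {φ : Formula PV} :
    box (next φ) ∈ w ↔ next (box φ) ∈ w :=
  iff_mem.1 (w.mem_of_derivable (.ax (h ⟨_, rfl⟩)))

theorem map_rel_map (h : axiomH PV ⊆ Ax) {w v : World Ax} (h₁ : w.rel v) :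
    w.map.rel v.map :=
  fun _ hφ => h₁ _ ((box_next_mem h).2 hφ)

/-- The world v extends the theory generated by the χ with □χ in w and the ○ψ with ψ in u. If that
theory contained p ∧ ¬p, then □○¬ψ would be in w for some ψ in u, and H would put ¬ψ into u. -/
theorem exists_map_eq [Nonempty PV] (h : axiomH PV ⊆ Ax) {w u : World Ax} (h₁ : w.map.rel u) :
    ∃ v, w.rel v ∧ v.map = u := by
  obtain ⟨p⟩ := ‹Nonempty PV›
  have hT : IsTheory Ax {χ | ∃ ψ ∈ u, box (imp (next ψ) χ) ∈ w} := by
    constructor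
    · intro φ hφ
      exact ⟨imp φ φ, imp_mem.2 id, box_mono (w.mem_of_derivable hφ.necBox)
        fun a => by simp only [propEval_imp]; tauto⟩
    · rintro φ χ ⟨ψ₁, hψ₁, h₁⟩ ⟨ψ₂, hψ₂, h₂⟩
      refine ⟨and ψ₁ ψ₂, and_mem.2 ⟨hψ₁, hψ₂⟩, ?_⟩
      have h₃ : box (imp (next (and ψ₁ ψ₂)) (and (next ψ₁) (next ψ₂))) ∈ w :=
        box_mem.2 fun v _ => imp_mem.2 fun h => and_mem.2 (next_and_mem.1 h)
      refine box_mem.2 fun v hv => imp_mem.2 fun h => ?_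
      have h' := next_and_mem.1 h
      exact mp (mp (hv _ h₂) h'.2) (mp (hv _ h₁) h'.1)
  have hbot : and (var p) (neg (var p)) ∉ {χ | ∃ ψ ∈ u, box (imp (next ψ) χ) ∈ w} := by
    rintro ⟨ψ, hψ, hb⟩
    have hb' : box (next (neg ψ)) ∈ w := by
      refine box_mem.2 fun v hv => next_neg_mem.2 fun h => ?_
      have := and_mem.1 (mp (hv _ hb) h)
      exact neg_mem.1 this.2 this.1
    exact neg_mem.1 (h₁ _ ((box_next_mem h).1 hb')) hψ
  obtain ⟨v, hv, -⟩ := hT.exists_world hbot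
  refine ⟨v, fun φ hφ => hv ⟨imp φ φ, imp_mem.2 id, ?_⟩, (eq_of_subset fun φ hφ => ?_).symm⟩
  · exact box_mono hφ fun a => by simp only [propEval_imp]; tauto
  · exact hv ⟨φ, hφ, box_mem.2 fun _ _ => imp_mem.2 id⟩

/-- By L, some successor refutes □φ → φ; this is a last point at which φ fails. -/
theorem exists_rel_of_loeb (h : axiomL PV ⊆ Ax) {w : World Ax} {φ : Formula PV}
    (hφ : box φ ∉ w) : ∃ v, w.rel v ∧ φ ∉ v ∧ box φ ∈ v := by
  have h₁ : box (imp (box φ) φ) ∉ w := fun h' =>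
    hφ (mp (w.mem_of_derivable (.ax (h ⟨_, rfl⟩))) h')
  obtain ⟨v, hv, h₂⟩ := exists_rel h₁
  rw [imp_mem] at h₂
  exact ⟨v, hv, fun h => h₂ fun _ => h, by_contra fun h => h₂ fun h' => absurd h' h⟩

end World

/-- The canonical frame. -/
def canonicalFrame (Ax : Set (Formula PV))
    (h : ∀ w v : World Ax, w.rel v → w.map = v.map ∨ w.map.rel v.map) : DynamicFrame.{u} :=
  ⟨World Ax, World.rel, World.map, h⟩

/-- The canonical valuation. -/
def canonicalValuation (Ax : Set (Formula PV)) (p : PV) : Set (World Ax) := {w | var p ∈ w}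

/-- The truth lemma. -/
theorem mem_truthSet_canonical
    {h : ∀ w v : World Ax, w.rel v → w.map = v.map ∨ w.map.rel v.map} (φ : Formula PV)
    (w : World Ax) :
    w ∈ truthSet (canonicalFrame Ax h).kripkeBox (canonicalFrame Ax h).map
      (canonicalValuation Ax) φ ↔ φ ∈ w := by
  induction φ generalizing w with
  | var p => rfl
  | and φ ψ h₁ h₂ => exact (and_congr (h₁ w) (h₂ w)).trans World.and_mem.symm
  | neg φ h => exact (not_congr (h w)).trans World.neg_mem.symm
  | box φ h => exact (forall_congr' fun v => imp_congr_right fun _ => h v).trans World.box_mem.symm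
  | next φ h => exact h w.map

theorem exists_world_not_mem {φ : Formula PV} (h : ¬ Derivable Ax φ) : ∃ w : World Ax, φ ∉ w :=
  let ⟨w, _, hw⟩ := isTheory_setOf_derivable.exists_world h
  ⟨w, hw⟩

end Canonical

/-! ### Finite sets of formulas closed under subformulas -/

namespace Formula

variable {PV : Type u}

/-- The nesting depth of `○`. -/
def nextDepth : Formula PV → ℕ
  | var _ => 0
  | and φ ψ => max φ.nextDepth ψ.nextDepth
  | neg φ => φ.nextDepth
  | box φ => φ.nextDepth
  | next φ => φ.nextDepth + 1

end Formula

/-- Sets of formulas that are closed under subformulas. -/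
structure SubformulaClosed {PV : Type u} (Γ : Set (Formula PV)) : Prop where
  and : ∀ {φ ψ}, Formula.and φ ψ ∈ Γ → φ ∈ Γ ∧ ψ ∈ Γ
  neg : ∀ {φ}, Formula.neg φ ∈ Γ → φ ∈ Γ
  box : ∀ {φ}, Formula.box φ ∈ Γ → φ ∈ Γ
  next : ∀ {φ}, Formula.next φ ∈ Γ → φ ∈ Γ

theorem SubformulaClosed.union {PV : Type u} {Γ Δ : Set (Formula PV)} (hΓ : SubformulaClosed Γ)
    (hΔ : SubformulaClosed Δ) : SubformulaClosed (Γ ∪ Δ) where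
  and h := h.elim (fun h => ⟨.inl (hΓ.and h).1, .inl (hΓ.and h).2⟩)
    fun h => ⟨.inr (hΔ.and h).1, .inr (hΔ.and h).2⟩
  neg h := h.imp hΓ.neg hΔ.neg
  box h := h.imp hΓ.box hΔ.box
  next h := h.imp hΓ.next hΔ.next

theorem exists_finite_subformulaClosed {PV : Type u} (φ : Formula PV) :
    ∃ Γ : Set (Formula PV), Γ.Finite ∧ SubformulaClosed Γ ∧ φ ∈ Γ := by
  induction φ with
  | var p => exact ⟨{var p}, finite_singleton _, ⟨by simp, by simp, by simp, by simp⟩, rfl⟩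
  | and φ ψ ih₁ ih₂ =>
    obtain ⟨Γ, hΓ, hc, h⟩ := ih₁
    obtain ⟨Δ, hΔ, hd, h'⟩ := ih₂
    have hu := hc.union hd
    refine ⟨insert (.and φ ψ) (Γ ∪ Δ), (hΓ.union hΔ).insert _, ⟨?_, ?_, ?_, ?_⟩, .inl rfl⟩
    · rintro _ _ (⟨rfl, rfl⟩ | hx)
      · exact ⟨.inr (.inl h), .inr (.inr h')⟩
      · exact ⟨.inr (hu.and hx).1, .inr (hu.and hx).2⟩
    · rintro _ (hx | hx)
      · cases hx
      · exact .inr (hu.neg hx)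
    · rintro _ (hx | hx)
      · cases hx
      · exact .inr (hu.box hx)
    · rintro _ (hx | hx)
      · cases hx
      · exact .inr (hu.next hx)
  | neg φ ih =>
    obtain ⟨Γ, hΓ, hc, h⟩ := ih
    refine ⟨insert (.neg φ) Γ, hΓ.insert _, ⟨?_, ?_, ?_, ?_⟩, .inl rfl⟩
    · rintro _ _ (hx | hx)
      · cases hx
      · exact ⟨.inr (hc.and hx).1, .inr (hc.and hx).2⟩
    · rintro _ (hx | hx)
      · cases hx
        exact .inr h
      · exact .inr (hc.neg hx)
    · rintro _ (hx | hx)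
      · cases hx
      · exact .inr (hc.box hx)
    · rintro _ (hx | hx)
      · cases hx
      · exact .inr (hc.next hx)
  | box φ ih =>
    obtain ⟨Γ, hΓ, hc, h⟩ := ih
    refine ⟨insert (.box φ) Γ, hΓ.insert _, ⟨?_, ?_, ?_, ?_⟩, .inl rfl⟩
    · rintro _ _ (hx | hx)
      · cases hx
      · exact ⟨.inr (hc.and hx).1, .inr (hc.and hx).2⟩
    · rintro _ (hx | hx)
      · cases hx
      · exact .inr (hc.neg hx)
    · rintro _ (hx | hx)
      · cases hx
        exact .inr h
      · exact .inr (hc.box hx)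
    · rintro _ (hx | hx)
      · cases hx
      · exact .inr (hc.next hx)
  | next φ ih =>
    obtain ⟨Γ, hΓ, hc, h⟩ := ih
    refine ⟨insert (.next φ) Γ, hΓ.insert _, ⟨?_, ?_, ?_, ?_⟩, .inl rfl⟩
    · rintro _ _ (hx | hx)
      · cases hx
      · exact ⟨.inr (hc.and hx).1, .inr (hc.and hx).2⟩
    · rintro _ (hx | hx)
      · cases hx
      · exact .inr (hc.neg hx)
    · rintro _ (hx | hx)
      · cases hx
      · exact .inr (hc.box hx)
    · rintro _ (hx | hx)
      · cases hx
        exact .inr h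
      · exact .inr (hc.next hx)

/-! ### Finite quotients of relations -/

def IsWeaklyTransitiveRel (W : Type u) (r : W → W → Prop) : Prop :=
  ∀ x y z, r x y → r y z → x = z ∨ r x z

def IsTransitiveRel (W : Type u) (r : W → W → Prop) : Prop :=
  ∀ x y z, r x y → r y z → r x z

def IsStrictOrderRel (W : Type u) (r : W → W → Prop) : Prop :=
  IsTransitiveRel W r ∧ ∀ x, ¬ r x x

/-- Every relation of the class has, for every finite colouring, a finite quotient in the class
that determines the colours and in which a point sees only the colours that it saw before. -/
def HasFiniteQuotients (K : ∀ W : Type u, (W → W → Prop) → Prop) : Prop :=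
  ∀ (M : Type u) (R : M → M → Prop), K M R → ∀ (ι : Type u) [Finite ι] (c : M → ι),
    ∃ (S : Type u) (r : S → S → Prop) (s : M → S), Finite S ∧ Function.Surjective s ∧ K S r ∧
      (∀ w v, s w = s v → c w = c v) ∧ (∀ w v, R w v → r (s w) (s v)) ∧
      ∀ w v, r (s w) (s v) → ∃ u, R w u ∧ c u = c v

/-- A state records the colours that a point sees and its own colour. One state sees another if it
sees the colour of the other and all that the other sees, which is transitive by construction and
lets a state see only colours that its points see. -/
theorem hasFiniteQuotients_transitive : HasFiniteQuotients.{u} IsTransitiveRel := by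
  intro M R hR ι _ c
  let T : M → Set ι := fun w => {a | ∃ v, R w v ∧ c v = a}
  let s : M → Set ι × ι := fun w => (T w, c w)
  refine ⟨range s, fun x y => insert y.1.2 y.1.1 ⊆ x.1.1, rangeFactorization s, inferInstance,
    rangeFactorization_surjective, ?_, ?_, ?_, ?_⟩
  · exact fun x y z h₁ h₂ => h₂.trans ((subset_insert _ _).trans h₁)
  · exact fun w v h => congrArg (fun x => x.1.2) h
  · rintro w v h a (rfl | ⟨u, hu, rfl⟩)
    · exact ⟨v, h, rfl⟩
    · exact ⟨u, hR _ _ _ h hu, rfl⟩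
  · exact fun w v h => h (mem_insert _ _)

/-! ### Finite quotients of weakly transitive relations. -/

section WeaklyTransitive

variable {M : Type u} (R : M → M → Prop) {ι : Type u} (c : M → ι)

/-- The colours that occur in the cone of a point. -/
def coneColours (w : M) : Set ι := {a | ∃ v, (w = v ∨ R w v) ∧ c v = a}

/-- The colours for which some point of the cone of `w` of that colour sees a point of the same
colour. -/
def multipleColours (w : M) : Set ι :=
  {a | ∃ v, (w = v ∨ R w v) ∧ c v = a ∧ ∃ u, R v u ∧ c u = a}

/-- The colours in the cluster of `w` that are not multiple. -/
def singleColours (w : M) : Set ι :=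
  {a | a ∉ multipleColours R c w ∧ ∃ v, (w = v ∨ R w v ∧ R v w) ∧ c v = a}

variable {R} {c}

theorem IsWeaklyTransitiveRel.cone_trans (hR : IsWeaklyTransitiveRel M R) {w v u : M}
    (h₁ : w = v ∨ R w v) (h₂ : v = u ∨ R v u) : w = u ∨ R w u := by
  rcases h₁ with rfl | h₁
  · exact h₂
  · rcases h₂ with rfl | h₂
    · exact .inr h₁
    · exact hR _ _ _ h₁ h₂

theorem coneColours_subset (hR : IsWeaklyTransitiveRel M R) {w v : M} (h : R w v) :
    coneColours R c v ⊆ coneColours R c w := by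
  rintro a ⟨u, hu, ha⟩
  exact ⟨u, hR.cone_trans (.inr h) hu, ha⟩

theorem multipleColours_subset (hR : IsWeaklyTransitiveRel M R) {w v : M} (h : R w v) :
    multipleColours R c v ⊆ multipleColours R c w := by
  rintro a ⟨u, hu, ha⟩
  exact ⟨u, hR.cone_trans (.inr h) hu, ha⟩

theorem exists_rel_of_mem_multipleColours {w : M}
    (h : c w ∈ multipleColours R c w) : ∃ u, R w u ∧ c u = c w := by
  obtain ⟨v, rfl | hv, hvc, hu⟩ := h
  · exact hu
  · exact ⟨v, hv, hvc⟩

theorem singleColours_subset (hR : IsWeaklyTransitiveRel M R) {w v : M} (h₁ : R w v)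
    (h₂ : R v w) : singleColours R c w ⊆ singleColours R c v := by
  rintro a ⟨ha, u, hu, hua⟩
  refine ⟨fun h => ha (multipleColours_subset hR h₁ h), u, ?_, hua⟩
  rcases hu with rfl | ⟨hu₁, hu₂⟩
  · exact .inr ⟨h₂, h₁⟩
  · rcases hR _ _ _ h₂ hu₁ with rfl | h
    · exact .inl rfl
    · rcases hR _ _ _ hu₂ h₁ with rfl | h'
      · exact .inl rfl
      · exact .inr ⟨h, h'⟩

/-- The relation on the states of the finite quotient of a weakly transitive relation. -/
def stateRel (x y : (Set ι × Set ι × Set ι) × ι) : Prop :=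
  (y.1.1 ⊆ x.1.1 ∧ y.1.2.1 ⊆ x.1.2.1 ∧ ∀ a ∈ x.1.2.2, a ∉ y.1.1) ∨
    (x.1 = y.1 ∧ (x.2 ≠ y.2 ∨ x.2 ∈ x.1.2.1))

theorem stateRel_weaklyTransitive {x y z : (Set ι × Set ι × Set ι) × ι} (h₁ : stateRel x y)
    (h₂ : stateRel y z) : x = z ∨ stateRel x z := by
  rcases h₁ with ⟨h₁, h₁', h₁''⟩ | ⟨h₁, h₁'⟩
  · refine .inr (.inl ?_)
    rcases h₂ with ⟨h₂, h₂', -⟩ | ⟨h₂, -⟩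
    · exact ⟨h₂.trans h₁, h₂'.trans h₁', fun a ha ha' => h₁'' a ha (h₂ ha')⟩
    · rw [← h₂]
      exact ⟨h₁, h₁', h₁''⟩
  · rcases h₂ with h₂ | ⟨h₂, h₂'⟩
    · refine .inr (.inl ?_)
      rw [h₁]
      exact h₂
    · by_cases h : x.2 = z.2
      · exact .inl (Prod.ext (h₁.trans h₂) h)
      · exact .inr (.inr ⟨h₁.trans h₂, .inl h⟩)

/-- A point w sees every colour of its cone other than c w, and it sees c w iff that colour is
multiple. So the only danger is that a state of single colour sees its own colour again. `stateRel`
forbids this both inside a cluster and below it. The latter is harmless: a single colour of the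
cluster of w is carried by one point of the cone only, and this point is not in the cone of v unless
v sees w. -/
theorem hasFiniteQuotients_weaklyTransitive :
    HasFiniteQuotients.{u} IsWeaklyTransitiveRel := by
  intro M R hR ι _ c
  let s : M → (Set ι × Set ι × Set ι) × ι := fun w =>
    ((coneColours R c w, multipleColours R c w, singleColours R c w), c w)
  refine ⟨range s, fun x y => stateRel x.1 y.1, rangeFactorization s, inferInstance,
    rangeFactorization_surjective, ?_, ?_, ?_, ?_⟩
  · exact fun x y z h₁ h₂ => (stateRel_weaklyTransitive h₁ h₂).imp_left Subtype.ext
  · exact fun w v h => congrArg (fun x => x.1.2) h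
  · intro w v h
    by_cases h' : R v w
    · refine .inr ⟨Prod.ext ?_ (Prod.ext ?_ ?_), ?_⟩
      · exact (coneColours_subset hR h').antisymm (coneColours_subset hR h)
      · exact (multipleColours_subset hR h').antisymm (multipleColours_subset hR h)
      · exact (singleColours_subset hR h h').antisymm (singleColours_subset hR h' h)
      · refine or_iff_not_imp_left.2 fun hne => ?_
        exact ⟨w, .inl rfl, rfl, v, h, (not_not.1 hne).symm⟩
    · refine .inl ⟨coneColours_subset hR h, multipleColours_subset hR h, ?_⟩
      rintro a ⟨ha, u, hu, hua⟩ ⟨x, hx, hxa⟩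
      -- If u = x, then the cone of v contains u and hence w, against `h'`. Otherwise u sees its own
      -- colour a, which is then multiple.
      have hux : u = x ∨ R u x := by
        refine hR.cone_trans ?_ (hR.cone_trans (.inr h) hx)
        exact hu.imp Eq.symm And.right
      rcases hux with rfl | hux
      · have hvw : v = w ∨ R v w := hR.cone_trans hx (hu.imp Eq.symm And.right)
        rcases hvw with rfl | hvw
        · exact h' h
        · exact h' hvw
      · exact ha ⟨u, hu.imp id And.left, hua, x, hux, hxa⟩
  · intro w v h
    have hw : c w ∈ multipleColours R c w ∨ c w ∈ singleColours R c w :=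
      or_iff_not_imp_left.2 fun h => ⟨h, w, .inl rfl, rfl⟩
    have hv : c v ∈ coneColours R c v := ⟨v, .inl rfl, rfl⟩
    have hvw : c v ∈ coneColours R c w := by
      rcases h with h | h
      · exact h.1 hv
      · have : coneColours R c w = coneColours R c v := congrArg Prod.fst h.1
        exact this ▸ hv
    obtain ⟨u, rfl | hu, huv⟩ := hvw
    · rw [← huv]
      refine exists_rel_of_mem_multipleColours ?_
      rcases h with h | h
      · exact hw.resolve_right fun hs => h.2.2 _ hs (huv ▸ hv)
      · exact h.2.resolve_left fun hne => hne huv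
    · exact ⟨u, hu, huv⟩

end WeaklyTransitive

/-! ### Stacking a relation on top of a dynamic frame -/

namespace DynamicFrame

/-- The set of worlds at which a formula is true. -/
abbrev truth {PV : Type v} (F : DynamicFrame.{u}) (V : PV → Set F.W) (φ : Formula PV) :
    Set F.W :=
  truthSet F.kripkeBox F.map V φ

/-- The disjoint union of a relation and a dynamic frame, where the points of the former are
mapped into the latter. -/
def stack {Q : Type u} (r : Q → Q → Prop) (D : DynamicFrame.{u}) (h : Q → D.W)
    (hh : ∀ q q', r q q' → h q = h q' ∨ D.rel (h q) (h q')) : DynamicFrame.{u} where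
  W := Q ⊕ D.W
  rel := Sum.LiftRel r D.rel
  map := Sum.elim (fun q => .inr (h q)) fun d => .inr (D.map d)
  weaklyMonotonic := by
    rintro _ _ (hr | hr)
    · exact (hh _ _ hr).imp (congrArg Sum.inr) Sum.LiftRel.inr
    · exact (D.weaklyMonotonic _ _ hr).imp (congrArg Sum.inr) Sum.LiftRel.inr

section Stack

variable {PV : Type v} {Q : Type u} {r : Q → Q → Prop} {D : DynamicFrame.{u}} {h : Q → D.W}
  {hh : ∀ q q', r q q' → h q = h q' ∨ D.rel (h q) (h q')} {A : PV → Set Q} {V : PV → Set D.W}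

/-- The valuation on a stack that is given by valuations on the two parts. -/
def stackValuation (r : Q → Q → Prop) (h : Q → D.W)
    (hh : ∀ q q', r q q' → h q = h q' ∨ D.rel (h q) (h q')) (A : PV → Set Q) (V : PV → Set D.W)
    (p : PV) : Set (stack r D h hh).W :=
  {x : Q ⊕ D.W | Sum.elim (· ∈ A p) (· ∈ V p) x}

/-- The lower part is closed under the relation and the map. -/
theorem inr_mem_truth_stack (φ : Formula PV) (d : D.W) :
    (Sum.inr d : Q ⊕ D.W) ∈ (stack r D h hh).truth (stackValuation r h hh A V) φ ↔
      d ∈ D.truth V φ := by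
  induction φ generalizing d with
  | var p => rfl
  | and φ ψ h₁ h₂ => exact and_congr (h₁ d) (h₂ d)
  | neg φ ih => exact not_congr (ih d)
  | next φ ih => exact ih (D.map d)
  | box φ ih =>
    constructor
    · exact fun hd d' hr => (ih d').1 (hd (.inr d') (.inr hr))
    · rintro hd _ (_ | hr)
      exact (ih _).2 (hd _ hr)

/-- The point q imitates l q. Boxes stay inside Q, whereas ○ moves to D and lowers the depth by one,
so D has to be faithful only up to depth n. -/
theorem inl_mem_truth_stack {M : DynamicFrame.{u}} {VM : PV → Set M.W} {Γ : Set (Formula PV)}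
    (hΓ : SubformulaClosed Γ) {n : ℕ} {l : Q → M.W}
    (hbox : ∀ ψ ∈ Γ, ∀ q, (∀ v, M.rel (l q) v → v ∈ M.truth VM ψ) ↔
      ∀ q', r q q' → l q' ∈ M.truth VM ψ)
    (hnext : ∀ ψ ∈ Γ, ψ.nextDepth < n → ∀ q, h q ∈ D.truth V ψ ↔ M.map (l q) ∈ M.truth VM ψ)
    {ψ : Formula PV} (hψ : ψ ∈ Γ) (hn : ψ.nextDepth < n + 1) (q : Q) :
    (Sum.inl q : Q ⊕ D.W) ∈ (stack r D h hh).truth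
      (stackValuation r h hh (fun p => l ⁻¹' VM p) V) ψ ↔ l q ∈ M.truth VM ψ := by
  induction ψ generalizing q with
  | var p => rfl
  | and φ ψ h₁ h₂ =>
    exact and_congr (h₁ (hΓ.and hψ).1 ((le_max_left _ _).trans_lt hn) q)
      (h₂ (hΓ.and hψ).2 ((le_max_right _ _).trans_lt hn) q)
  | neg φ ih => exact not_congr (ih (hΓ.neg hψ) hn q)
  | next φ ih =>
    exact (inr_mem_truth_stack φ (h q)).trans
      (hnext φ (hΓ.next hψ) (Nat.lt_of_succ_lt_succ hn) q)
  | box φ ih =>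
    refine Iff.trans ?_ (hbox φ (hΓ.box hψ) q).symm
    constructor
    · exact fun hd q' hr => (ih (hΓ.box hψ) hn q').1 (hd (.inl q') (.inl hr))
    · rintro hd _ (hr | _)
      exact (ih (hΓ.box hψ) hn _).2 (hd _ hr)

end Stack

end DynamicFrame

/-- Classes of relations that contain an irreflexive point and are closed under disjoint unions. -/
structure IsAdditiveClass (K : ∀ W : Type u, (W → W → Prop) → Prop) : Prop where
  point : K PUnit fun _ _ => False
  sum : ∀ {Q D : Type u} {r : Q → Q → Prop} {t : D → D → Prop}, K Q r → K D t →
    K (Q ⊕ D) (Sum.LiftRel r t)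

theorem isAdditiveClass_weaklyTransitive : IsAdditiveClass.{u} IsWeaklyTransitiveRel where
  point _ _ _ h := h.elim
  sum hr ht := by
    rintro _ _ _ (h₁ | h₁) (h₂ | h₂)
    · exact (hr _ _ _ h₁ h₂).imp (congrArg Sum.inl) Sum.LiftRel.inl
    · exact (ht _ _ _ h₁ h₂).imp (congrArg Sum.inr) Sum.LiftRel.inr

theorem isAdditiveClass_transitive : IsAdditiveClass.{u} IsTransitiveRel where
  point _ _ _ h := h.elim
  sum hr ht := by
    rintro _ _ _ (h₁ | h₁) (h₂ | h₂)
    · exact .inl (hr _ _ _ h₁ h₂)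
    · exact .inr (ht _ _ _ h₁ h₂)

theorem isAdditiveClass_strictOrder : IsAdditiveClass.{u} IsStrictOrderRel where
  point := ⟨isAdditiveClass_transitive.point, fun _ h => h⟩
  sum hr ht := ⟨isAdditiveClass_transitive.sum hr.1 ht.1, by
    rintro _ (h | h)
    · exact hr.2 _ h
    · exact ht.2 _ h⟩

/-! ### Finite layers for the logics with C but without L. -/

namespace DynamicFrame

/-- The frame with one irreflexive point. -/
def point : DynamicFrame.{u} := ⟨PUnit, fun _ _ => False, id, fun _ _ h => h.elim⟩

/-- In a finite quotient, as many steps of the map as needed can be simulated. -/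
theorem exists_finite_layers {PV : Type u} {K : ∀ W : Type u, (W → W → Prop) → Prop}
    (hK : HasFiniteQuotients K) (hK' : IsAdditiveClass K) {M : DynamicFrame.{u}}
    (hM : K M.W M.rel) (VM : PV → Set M.W) {Γ : Set (Formula PV)} (hfin : Γ.Finite)
    (hΓ : SubformulaClosed Γ) (n : ℕ) :
    ∃ (D : DynamicFrame.{u}) (V : PV → Set D.W) (π : M.W → D.W), Finite D.W ∧ K D.W D.rel ∧
      (∀ w v, M.rel w v → π w = π v ∨ D.rel (π w) (π v)) ∧
      ∀ ψ ∈ Γ, ψ.nextDepth < n → ∀ w, π w ∈ D.truth V ψ ↔ w ∈ M.truth VM ψ := by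
  induction n with
  | zero =>
    exact ⟨point, fun _ => ∅, fun _ => PUnit.unit, inferInstanceAs (Finite PUnit), hK'.point,
      fun _ _ _ => .inl rfl, fun _ _ h => absurd h (Nat.not_lt_zero _)⟩
  | succ n ih =>
    obtain ⟨D, V, π, hD, hKD, hπ, htruth⟩ := ih
    have : Finite Γ := hfin
    -- Besides the true formulas of Γ, the colour records where the image of the world lies in the
    -- frame built so far.
    let c : M.W → Set Γ × D.W := fun w => ({ψ | w ∈ M.truth VM ψ}, π (M.map w))
    obtain ⟨Q, r, s, hQ, hs, hKr, hc, hmono, hback⟩ := hK M.W M.rel hM _ c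
    choose l hl using hs
    have hcl : ∀ w, c (l (s w)) = c w := fun w => hc _ _ (hl _)
    have hcc : ∀ {w v}, c w = c v → ∀ ψ ∈ Γ, w ∈ M.truth VM ψ ↔ v ∈ M.truth VM ψ := by
      intro w v h ψ hψ
      exact Set.ext_iff.1 (congrArg Prod.fst h) ⟨ψ, hψ⟩
    have hback' : ∀ q q', r q q' → ∃ u, M.rel (l q) u ∧ c u = c (l q') := by
      intro q q' h
      refine hback _ _ ?_
      rwa [hl, hl]
    -- An edge of the quotient comes from an edge l q → u of M with u of the colour of l q'. As the
    -- colour determines the image in D, weak monotonicity at l q → u suffices.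
    have hh : ∀ q q', r q q' → π (M.map (l q)) = π (M.map (l q')) ∨
        D.rel (π (M.map (l q))) (π (M.map (l q'))) := by
      intro q q' h
      obtain ⟨u, hu, huc⟩ := hback' q q' h
      have : π (M.map u) = π (M.map (l q')) := congrArg Prod.snd huc
      rw [← this]
      rcases M.weaklyMonotonic _ _ hu with h' | h'
      · exact .inl (congrArg π h')
      · exact hπ _ _ h'
    refine ⟨stack r D (fun q => π (M.map (l q))) hh,
      stackValuation r _ hh (fun p => l ⁻¹' VM p) V, fun w => .inl (s w),
      inferInstanceAs (Finite (Q ⊕ D.W)), hK'.sum hKr hKD,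
      fun w v h => .inr (.inl (hmono w v h)), fun ψ hψ hn w => ?_⟩
    refine (inl_mem_truth_stack hΓ ?_ (fun ψ hψ hn q => htruth ψ hψ hn _) hψ hn (s w)).trans
      (hcc (hcl w) ψ hψ)
    intro ψ hψ q
    constructor
    · intro h q' hr
      obtain ⟨u, hu, huc⟩ := hback' q q' hr
      exact (hcc huc ψ hψ).1 (h u hu)
    · intro h v hv
      refine (hcc (hcl v) ψ hψ).1 (h (s v) ?_)
      have := hmono _ _ hv
      rwa [hl] at this

end DynamicFrame

/-! ### Finite selections -/

/-- Finite quotients yield finite selections of points that preserve the boxes of finitely many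
sets. -/
theorem HasFiniteQuotients.exists_selection {K : ∀ W : Type u, (W → W → Prop) → Prop}
    (hK : HasFiniteQuotients K) {M : Type u} {R : M → M → Prop} (hR : K M R)
    {𝒜 : Set (Set M)} (h𝒜 : 𝒜.Finite) (w : M) :
    ∃ (Q : Type u) (r : Q → Q → Prop) (l : Q → M) (q₀ : Q), Finite Q ∧ K Q r ∧
      (∀ A ∈ 𝒜, l q₀ ∈ A ↔ w ∈ A) ∧
      ∀ A ∈ 𝒜, ∀ q, (∀ v, R (l q) v → v ∈ A) ↔ ∀ q', r q q' → l q' ∈ A := by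
  have : Finite 𝒜 := h𝒜
  let c : M → Set 𝒜 := fun w => {A | w ∈ A.1}
  obtain ⟨Q, r, s, hQ, hs, hKr, hc, hmono, hback⟩ := hK M R hR _ c
  choose l hl using hs
  have hcc : ∀ {w v}, c w = c v → ∀ A ∈ 𝒜, w ∈ A ↔ v ∈ A :=
    fun h A hA => Set.ext_iff.1 h ⟨A, hA⟩
  have hcl : ∀ w, c (l (s w)) = c w := fun w => hc _ _ (hl _)
  refine ⟨Q, r, l, s w, hQ, hKr, hcc (hcl w), fun A hA q => ⟨fun h q' hr => ?_, fun h v hv => ?_⟩⟩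
  · obtain ⟨u, hu, huc⟩ := hback (l q) (l q') (by rwa [hl, hl])
    exact (hcc huc A hA).1 (h u hu)
  · refine (hcc (hcl v) A hA).1 (h (s v) ?_)
    have := hmono _ _ hv
    rwa [hl] at this

/-! ### The tree of paths of a transitive relation -/

section Path

variable {M : Type u}

/-- Nonempty finite paths of a transitive relation; the last point is the head of the list. -/
def Path (R : M → M → Prop) : Type u :=
  {l : List M // l ≠ [] ∧ l.Pairwise fun a b => R b a}

namespace Path

variable {R : M → M → Prop}

/-- The end point of a path. -/
def last (p : Path R) : M := p.1.head p.2.1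

/-- Proper extension of paths. -/
def rel (p q : Path R) : Prop := p.1 <:+ q.1 ∧ p.1 ≠ q.1

theorem isStrictOrderRel_rel : IsStrictOrderRel (Path R) rel := by
  refine ⟨fun p q s h₁ h₂ => ⟨h₁.1.trans h₂.1, fun h => h₁.2 ?_⟩, fun p h => h.2 rfl⟩
  refine h₁.1.eq_of_length_le ?_
  rw [h]
  exact h₂.1.length_le

theorem rel_last {p q : Path R} (h : rel p q) : R p.last q.last := by
  obtain ⟨⟨t, ht⟩, hne⟩ := h
  have htn : t ≠ [] := by
    rintro rfl
    exact hne ht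
  have hq := q.2.2
  rw [← ht, List.pairwise_append] at hq
  have hlast : q.last = t.head htn := by
    simp only [last, ← ht]
    exact List.head_append_of_ne_nil _
  rw [hlast]
  exact hq.2.2 _ (List.head_mem _) _ (List.head_mem p.2.1)

/-- The path of length one. -/
def single (R : M → M → Prop) (w : M) : Path R := ⟨[w], List.cons_ne_nil _ _, by simp⟩

theorem exists_rel_last_eq (hR : IsTransitiveRel M R) (p : Path R) {v : M} (h : R p.last v) :
    ∃ q, rel p q ∧ q.last = v := by
  obtain ⟨l, hl, hp⟩ := p
  cases l with
  | nil => exact absurd rfl hl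
  | cons a l =>
    refine ⟨⟨v :: a :: l, List.cons_ne_nil _ _, List.pairwise_cons.2 ⟨?_, hp⟩⟩,
      ⟨List.suffix_cons _ _, fun h => ?_⟩, rfl⟩
    · intro b hb
      rcases List.mem_cons.1 hb with rfl | hb
      · exact h
      · exact hR _ _ _ ((List.pairwise_cons.1 hp).1 b hb) h
    · exact absurd (congrArg List.length h) (by simp)

end Path

open scoped Classical in
/-- The image of a list under a map, where repetitions in the image are dropped. -/
noncomputable def collapse (g : M → M) : List M → List M
  | [] => []
  | a :: l => if (collapse g l).head? = some (g a) then collapse g l else g a :: collapse g l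

theorem head?_collapse (g : M → M) (l : List M) : (collapse g l).head? = l.head?.map g := by
  cases l with
  | nil => rfl
  | cons a l =>
    rw [collapse]
    split_ifs with h
    · exact h
    · rfl

/-- Lists are processed from the tail, so extending a path leaves the image of the old part intact.
This makes the induced map on paths weakly monotonic. -/
theorem collapse_suffix (g : M → M) {l l' : List M} (h : l <:+ l') :
    collapse g l <:+ collapse g l' := by
  induction l' with
  | nil => rw [List.suffix_nil.1 h]
  | cons a l' ih =>
    rcases List.suffix_cons_iff.1 h with rfl | h
    · exact List.suffix_rfl
    · refine (ih h).trans ?_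
      rw [collapse]
      split_ifs
      · exact List.suffix_rfl
      · exact List.suffix_cons _ _

/-- A new value g a is recorded only if it differs from the last value g c; then weak monotonicity
relates g c to g a, and transitivity relates the earlier values to g a. -/
theorem pairwise_collapse {R : M → M → Prop} (hR : IsTransitiveRel M R) {g : M → M}
    (hg : ∀ w v, R w v → g w = g v ∨ R (g w) (g v)) {l : List M}
    (h : l.Pairwise fun a b => R b a) : (collapse g l).Pairwise fun a b => R b a := by
  induction l with
  | nil => exact List.Pairwise.nil
  | cons a l ih =>
    rw [List.pairwise_cons] at h
    have ih := ih h.2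
    rw [collapse]
    split_ifs with hd
    · exact ih
    · refine List.pairwise_cons.2 ⟨?_, ih⟩
      have hhead := head?_collapse g l
      cases l with
      | nil => simp [collapse]
      | cons c l =>
        generalize collapse g (c :: l) = l' at hhead hd ih
        cases l' with
        | nil => simp
        | cons d l' =>
          simp only [List.head?_cons, Option.map_some, Option.some.injEq] at hhead hd
          subst hhead
          have hca : R (g c) (g a) := (hg _ _ (h.1 c List.mem_cons_self)).resolve_left hd
          intro b hb
          rcases List.mem_cons.1 hb with rfl | hb
          · exact hca
          · exact hR _ _ _ ((List.pairwise_cons.1 ih).1 b hb) hca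

theorem collapse_ne_nil (g : M → M) {l : List M} (h : l ≠ []) : collapse g l ≠ [] := by
  intro h'
  have := head?_collapse g l
  rw [h', List.head?_eq_some_head h] at this
  cases this

/-- The image of a path under a weakly monotonic map. -/
noncomputable def Path.map {R : M → M → Prop} (hR : IsTransitiveRel M R) {g : M → M}
    (hg : ∀ w v, R w v → g w = g v ∨ R (g w) (g v)) (p : Path R) : Path R :=
  ⟨collapse g p.1, collapse_ne_nil g p.2.1, pairwise_collapse hR hg p.2.2⟩

theorem Path.last_map {R : M → M → Prop} (hR : IsTransitiveRel M R) {g : M → M}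
    (hg : ∀ w v, R w v → g w = g v ∨ R (g w) (g v)) (p : Path R) :
    (p.map hR hg).last = g p.last := by
  have h : (p.map hR hg).1.head? = p.1.head?.map g := head?_collapse g p.1
  rw [List.head?_eq_some_head p.2.1, List.head?_eq_some_head (p.map hR hg).2.1] at h
  exact Option.some.inj h

/-- The dynamic frame of the paths of a transitive dynamic frame. -/
noncomputable def pathFrame (F : DynamicFrame.{u}) (hF : IsTransitiveRel F.W F.rel) :
    DynamicFrame.{u} where
  W := Path F.rel
  rel := Path.rel
  map := Path.map hF F.weaklyMonotonic
  weaklyMonotonic _ _ h :=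
    or_iff_not_imp_left.2 fun hne => ⟨collapse_suffix F.map h.1, fun h' => hne (Subtype.ext h')⟩

/-- Löb's principle for a set with respect to a relation. -/
def LoebSet (R : M → M → Prop) (A : Set M) : Prop :=
  ∀ w, (∃ v, R w v ∧ v ∉ A) → ∃ v, R w v ∧ v ∉ A ∧ ∀ u, R v u → u ∈ A

/-- Induction on the number of sets in 𝒜 whose box fails at the end of the path. Extending the path
by a Löb witness for A makes the box of A true, and by transitivity no other box begins to fail, so
the number drops. -/
theorem exists_finite_closed_paths_of_path {R : M → M → Prop} (hR : IsTransitiveRel M R)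
    {𝒜 : Set (Set M)} (h𝒜 : 𝒜.Finite) (hL : ∀ A ∈ 𝒜, LoebSet R A) (p : Path R) :
    ∃ E : Set (Path R), E.Finite ∧ p ∈ E ∧ ∀ q ∈ E, ∀ A ∈ 𝒜, (∃ v, R q.last v ∧ v ∉ A) →
      ∃ q' ∈ E, q.rel q' ∧ q'.last ∉ A := by
  let ℬ : Path R → Set (Set M) := fun p => {A ∈ 𝒜 | ∃ v, R p.last v ∧ v ∉ A}
  have hℬ : ∀ p, (ℬ p).Finite := fun p => h𝒜.subset fun A hA => hA.1
  induction hk : (ℬ p).ncard using Nat.strong_induction_on generalizing p with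
  | _ k ih =>
    have hstep : ∀ A : ℬ p, ∃ q : Path R, p.rel q ∧ q.last ∉ A.1 ∧
        ∃ E : Set (Path R), E.Finite ∧ q ∈ E ∧ ∀ q ∈ E, ∀ A ∈ 𝒜, (∃ v, R q.last v ∧ v ∉ A) →
          ∃ q' ∈ E, q.rel q' ∧ q'.last ∉ A := by
      rintro ⟨A, hA, hv⟩
      obtain ⟨v, hpv, hvA, hvu⟩ := hL A hA _ hv
      obtain ⟨q, hpq, rfl⟩ := p.exists_rel_last_eq hR hpv
      refine ⟨q, hpq, hvA, ih _ ?_ q rfl⟩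
      rw [← hk]
      refine ncard_lt_ncard ⟨?_, fun h => ?_⟩ (hℬ p)
      · rintro B ⟨hB, u, hu, huB⟩
        exact ⟨hB, u, hR _ _ _ hpv hu, huB⟩
      · obtain ⟨-, u, hu, huA⟩ := h ⟨hA, hv⟩
        exact huA (hvu u hu)
    choose f hf₁ hf₂ E hE₁ hE₂ hE₃ using hstep
    have := (hℬ p).to_subtype
    refine ⟨insert p (⋃ A, E A), (finite_iUnion hE₁).insert p, mem_insert _ _, ?_⟩
    rintro q (rfl | hq) A hA hv
    · exact ⟨f ⟨A, hA, hv⟩, .inr (mem_iUnion.2 ⟨_, hE₂ _⟩), hf₁ _, hf₂ ⟨A, hA, hv⟩⟩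
    · obtain ⟨B, hB⟩ := mem_iUnion.1 hq
      obtain ⟨q', hq', h⟩ := hE₃ B q hB A hA hv
      exact ⟨q', .inr (mem_iUnion.2 ⟨B, hq'⟩), h⟩

/-- Finite sets of paths extend to finite sets of paths in which the failure of a box is always
witnessed. -/
theorem exists_finite_closed_paths {R : M → M → Prop} (hR : IsTransitiveRel M R)
    {𝒜 : Set (Set M)} (h𝒜 : 𝒜.Finite) (hL : ∀ A ∈ 𝒜, LoebSet R A) {E : Set (Path R)}
    (hE : E.Finite) :
    ∃ E' : Set (Path R), E'.Finite ∧ E ⊆ E' ∧ ∀ A ∈ 𝒜, ∀ q : E',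
      (∀ v, R q.1.last v → v ∈ A) ↔ ∀ q' : E', q.1.rel q'.1 → q'.1.last ∈ A := by
  choose C hC₁ hC₂ hC₃ using exists_finite_closed_paths_of_path hR h𝒜 hL
  refine ⟨⋃ p ∈ E, C p, hE.biUnion fun p _ => hC₁ p,
    fun p hp => mem_biUnion hp (hC₂ p), fun A hA q => ⟨fun h q' hq' => ?_, fun h => ?_⟩⟩
  · exact h _ (Path.rel_last hq')
  · by_contra! hv
    obtain ⟨p, hp, hq⟩ := mem_iUnion₂.1 q.2
    obtain ⟨q', hq', hr, hA'⟩ := hC₃ p q.1 hq A hA hv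
    exact hA' (h ⟨q', mem_biUnion hp hq'⟩ hr)

/-- Finite selections for relations that satisfy Löb's principle. -/
theorem exists_selection_of_loeb {R : M → M → Prop} (hR : IsTransitiveRel M R)
    {𝒜 : Set (Set M)} (h𝒜 : 𝒜.Finite) (hL : ∀ A ∈ 𝒜, LoebSet R A) (w : M) :
    ∃ (Q : Type u) (r : Q → Q → Prop) (l : Q → M) (q₀ : Q), Finite Q ∧ IsStrictOrderRel Q r ∧
      (∀ A ∈ 𝒜, l q₀ ∈ A ↔ w ∈ A) ∧
      ∀ A ∈ 𝒜, ∀ q, (∀ v, R (l q) v → v ∈ A) ↔ ∀ q', r q q' → l q' ∈ A := by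
  obtain ⟨E, hE, hwE, hbox⟩ :=
    exists_finite_closed_paths hR h𝒜 hL (finite_singleton (Path.single R w))
  refine ⟨E, fun q q' => q.1.rel q'.1, fun q => q.1.last, ⟨Path.single R w, hwE rfl⟩, hE,
    ⟨fun x y z => Path.isStrictOrderRel_rel.1 _ _ _, fun x => Path.isStrictOrderRel_rel.2 _⟩,
    fun A _ => Iff.rfl, hbox⟩

end Path

/-! ### Finite layers of paths for GLC. -/

namespace DynamicFrame

/-- In a finite set of paths, as many steps of the map as needed can be simulated. -/
theorem exists_finite_layers_of_loeb {PV : Type u} {M : DynamicFrame.{u}}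
    (hM : IsTransitiveRel M.W M.rel) (VM : PV → Set M.W) {Γ : Set (Formula PV)}
    (hfin : Γ.Finite) (hΓ : SubformulaClosed Γ)
    (hL : ∀ ψ ∈ Γ, LoebSet M.rel (M.truth VM ψ)) (n : ℕ) {E : Set (Path M.rel)}
    (hE : E.Finite) :
    ∃ (D : DynamicFrame.{u}) (V : PV → Set D.W) (j : E → D.W), Finite D.W ∧
      IsStrictOrderRel D.W D.rel ∧ (∀ p q : E, p.1.rel q.1 → D.rel (j p) (j q)) ∧
      ∀ ψ ∈ Γ, ψ.nextDepth < n → ∀ p, j p ∈ D.truth V ψ ↔ p.1.last ∈ M.truth VM ψ := by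
  have hrel : ∀ E : Set (Path M.rel), IsStrictOrderRel E fun q q' => q.1.rel q'.1 := fun E =>
    ⟨fun x y z => Path.isStrictOrderRel_rel.1 _ _ _, fun x => Path.isStrictOrderRel_rel.2 _⟩
  have : Finite E := hE
  induction n generalizing E with
  | zero =>
    exact ⟨⟨E, fun q q' => q.1.rel q'.1, id, fun _ _ => .inr⟩, fun _ => ∅, id, hE, hrel E,
      fun _ _ h => h, fun _ _ h => absurd h (Nat.not_lt_zero _)⟩
  | succ n ih =>
    -- The top layer is E closed under witnesses; the images of all its paths form the finite set
    -- for which the next layers are built.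
    obtain ⟨E', hE', hEE', hbox⟩ := exists_finite_closed_paths hM (hfin.image (M.truth VM))
      (by rintro _ ⟨ψ, hψ, rfl⟩; exact hL ψ hψ) hE
    let g : Path M.rel → Path M.rel := Path.map hM M.weaklyMonotonic
    have hgE := hE'.image g
    obtain ⟨D, V, j, hD, hKD, hj, htruth⟩ := ih hgE hgE
    have : Finite E' := hE'
    -- The images of a path and of an extension are equal or again related by extension, and j
    -- preserves the latter.
    have hk : ∀ p q : E', p.1.rel q.1 → j ⟨g p.1, mem_image_of_mem g p.2⟩ =
        j ⟨g q.1, mem_image_of_mem g q.2⟩ ∨ D.rel (j ⟨g p.1, mem_image_of_mem g p.2⟩)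
        (j ⟨g q.1, mem_image_of_mem g q.2⟩) := by
      intro p q h
      rcases (pathFrame M hM).weaklyMonotonic _ _ h with h | h
      · exact .inl (congrArg j (Subtype.ext h))
      · exact .inr (hj _ _ h)
    refine ⟨stack _ D _ hk, stackValuation _ _ hk (fun p => (fun q : E' => q.1.last) ⁻¹' VM p) V,
      fun p => .inl ⟨p.1, hEE' p.2⟩, inferInstanceAs (Finite (E' ⊕ D.W)),
      isAdditiveClass_strictOrder.sum (hrel E') hKD, fun p q h => Sum.LiftRel.inl h,
      fun ψ hψ hn p => ?_⟩
    refine inl_mem_truth_stack hΓ (fun ψ hψ => hbox _ (mem_image_of_mem _ hψ))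
      (fun ψ hψ hn q => (htruth ψ hψ hn _).trans ?_) hψ hn _
    exact iff_of_eq (congrArg (· ∈ M.truth VM ψ) (Path.last_map hM M.weaklyMonotonic q.1))

/-! ### Cyclic frames -/

/-- Copies of a relation that are permuted cyclically. -/
def cyclic {Q : Type u} (r : Q → Q → Prop) (n : ℕ) : DynamicFrame.{u} where
  W := Q × Fin (n + 1)
  rel x y := r x.1 y.1 ∧ x.2 = y.2
  map x := (x.1, x.2 + 1)
  weaklyMonotonic _ _ h := .inr ⟨h.1, congrArg (· + 1) h.2⟩

theorem isInvertible_cyclic {Q : Type u} (r : Q → Q → Prop) (n : ℕ) :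
    (cyclic r n).IsInvertible := by
  refine ⟨?_, fun x y => and_congr_right fun _ => (add_left_inj (1 : Fin (n + 1))).symm⟩
  exact ((Equiv.refl Q).prodCongr (Equiv.addRight (1 : Fin (n + 1)))).bijective

/-- The point (q, i) imitates the i-fold image of l q. The bound on i plus the depth ensures that
the step from n back to 0 is never used. By `hhom` and `hback`, the successors of the i-fold image
of l q are the i-fold images of its successors, so the same relation r serves in every copy. -/
theorem mem_truth_cyclic {PV : Type v} {Q : Type u} {r : Q → Q → Prop} {M : DynamicFrame.{u}}
    {VM : PV → Set M.W} {Γ : Set (Formula PV)} (hΓ : SubformulaClosed Γ) {n : ℕ} {l : Q → M.W}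
    (hhom : ∀ w v, M.rel w v → M.rel (M.map w) (M.map v))
    (hback : ∀ w u, M.rel (M.map w) u → ∃ v, M.rel w v ∧ M.map v = u)
    (hbox : ∀ ψ ∈ Γ, ∀ i ≤ n, ∀ q, (∀ v, M.rel (l q) v → M.map^[i] v ∈ M.truth VM ψ) ↔
      ∀ q', r q q' → M.map^[i] (l q') ∈ M.truth VM ψ)
    {ψ : Formula PV} (hψ : ψ ∈ Γ) (q : Q) (i : Fin (n + 1)) (hn : i.1 + ψ.nextDepth ≤ n) :
    ((q, i) : Q × Fin (n + 1)) ∈ (cyclic r n).truth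
      (fun p => {x : Q × Fin (n + 1) | M.map^[x.2.1] (l x.1) ∈ VM p}) ψ ↔
      M.map^[i.1] (l q) ∈ M.truth VM ψ := by
  have hiter : ∀ (i : ℕ) (w u : M.W), M.rel (M.map^[i] w) u ↔
      ∃ v, M.rel w v ∧ M.map^[i] v = u := by
    intro i
    induction i with
    | zero => simp
    | succ i ih =>
      intro w u
      rw [Function.iterate_succ_apply']
      constructor
      · intro h
        obtain ⟨v, hv, rfl⟩ := hback _ _ h
        obtain ⟨x, hx, rfl⟩ := (ih _ _).1 hv
        exact ⟨x, hx, Function.iterate_succ_apply' _ _ _⟩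
      · rintro ⟨v, hv, rfl⟩
        rw [Function.iterate_succ_apply']
        exact hhom _ _ ((ih _ _).2 ⟨v, hv, rfl⟩)
  induction ψ generalizing q i with
  | var p => rfl
  | and φ ψ h₁ h₂ =>
    simp only [nextDepth] at hn
    exact and_congr (h₁ (hΓ.and hψ).1 q i (by omega)) (h₂ (hΓ.and hψ).2 q i (by omega))
  | neg φ ih => exact not_congr (ih (hΓ.neg hψ) q i hn)
  | next φ ih =>
    simp only [nextDepth] at hn
    -- Since ○φ has positive depth, i < n and the addition does not wrap around.
    have hi : (i + 1).1 = i.1 + 1 := Fin.val_add_one_of_lt (Fin.lt_def.2 (by simp; omega))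
    refine (ih (hΓ.next hψ) q (i + 1) (by omega)).trans ?_
    rw [hi, Function.iterate_succ_apply']
    rfl
  | box φ ih =>
    have hn' : i.1 + φ.nextDepth ≤ n := hn
    have hb := hbox φ (hΓ.box hψ) i (by omega) q
    constructor
    · intro h u hu
      obtain ⟨v, hv, rfl⟩ := (hiter _ _ _).1 hu
      exact hb.2 (fun q' hq' => (ih (hΓ.box hψ) q' i hn').1 (h (q', i) ⟨hq', rfl⟩)) v hv
    · rintro h ⟨q', i'⟩ ⟨hq', hi'⟩
      obtain rfl : i = i' := hi'
      refine (ih (hΓ.box hψ) q' i hn').2 (hb.1 (fun v hv => ?_) q' hq')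
      exact h _ ((hiter _ _ _).2 ⟨v, hv, rfl⟩)

end DynamicFrame

/-! ### Transfer between frames and dynamic topological systems -/

namespace DynamicFrame

/-- If a frame refutes a formula, then so does every frame of which it is a p-morphic image. -/
theorem not_valid_of_pMorphism {PV : Type*} {F : DynamicFrame.{u}} {F' : DynamicFrame.{v}}
    (π : F'.W → F.W) (hπ : Function.Surjective π) (hmap : ∀ x, π (F'.map x) = F.map (π x))
    (forth : ∀ x y, F'.rel x y → F.rel (π x) (π y))
    (back : ∀ x z, F.rel (π x) z → ∃ y, F'.rel x y ∧ π y = z) {φ : Formula PV}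
    (h : ¬ F.Valid φ) : ¬ F'.Valid φ := by
  refine fun h' => h fun V => eq_univ_of_forall fun w => ?_
  have key : ∀ (ψ : Formula PV) (x : F'.W),
      x ∈ F'.truth (fun p => π ⁻¹' V p) ψ ↔ π x ∈ F.truth V ψ := by
    intro ψ
    induction ψ with
    | var p => exact fun x => Iff.rfl
    | and ψ χ h₁ h₂ => exact fun x => and_congr (h₁ x) (h₂ x)
    | neg ψ ih => exact fun x => not_congr (ih x)
    | next ψ ih =>
      intro x
      refine (ih _).trans ?_
      rw [hmap]
      rfl
    | box ψ ih =>
      refine fun x => ⟨fun hx z hz => ?_, fun hx y hy => (ih y).2 (hx _ (forth _ _ hy))⟩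
      obtain ⟨y, hy, rfl⟩ := back x z hz
      exact (ih y).1 (hx y hy)
  obtain ⟨x, rfl⟩ := hπ w
  refine (key φ x).1 ?_
  rw [truth, h']
  trivial

/-- Finite frames have isomorphic copies in every universe. -/
theorem exists_finite_copy {PV : Type*} {F : DynamicFrame.{u}} (hF : Finite F.W)
    {φ : Formula PV} (hφ : ¬ F.Valid φ) :
    ∃ F' : DynamicFrame.{v}, Finite F'.W ∧ (F.IsWK4 → F'.IsWK4) ∧ (F.IsK4 → F'.IsK4) ∧
      (F.IsGL → F'.IsGL) ∧ (F.IsInvertible → F'.IsInvertible) ∧ ¬ F'.Valid φ := by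
  obtain ⟨n, ⟨e₀⟩⟩ := Finite.exists_equiv_fin F.W
  let e : ULift.{v} (Fin n) ≃ F.W := Equiv.ulift.trans e₀.symm
  let F' : DynamicFrame.{v} := ⟨ULift.{v} (Fin n), fun x y => F.rel (e x) (e y),
    fun x => e.symm (F.map (e x)), fun x y h => (F.weaklyMonotonic _ _ h).imp
      (congrArg e.symm) (by simp)⟩
  have hmap : ∀ x, e (F'.map x) = F.map (e x) := fun x => e.apply_symm_apply _
  have hK4 : F.IsK4 → F'.IsK4 := fun h x y z => h (e x) (e y) (e z)
  refine ⟨F', inferInstanceAs (Finite (ULift.{v} (Fin n))), ?_, hK4, ?_, ?_, ?_⟩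
  · exact fun h x y z h₁ h₂ => (h _ _ _ h₁ h₂).imp_left fun h => e.injective h
  · exact fun h => ⟨hK4 h.1, InvImage.wf e h.2⟩
  · refine fun h => ⟨(e.symm.bijective.comp h.1).comp e.bijective, fun x y => ?_⟩
    show F.rel (e x) (e y) ↔ F.rel (e (F'.map x)) (e (F'.map y))
    rw [hmap, hmap]
    exact h.2 _ _
  · refine not_valid_of_pMorphism (F' := F') e e.surjective hmap (fun _ _ h => h)
      (fun x z hz => ⟨e.symm z, ?_, e.apply_symm_apply z⟩) hφ
    show F.rel (e x) (e (e.symm z))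
    rwa [e.apply_symm_apply]

theorem isGL_of_isStrictOrderRel {F : DynamicFrame.{u}} (hF : Finite F.W)
    (h : IsStrictOrderRel F.W F.rel) : F.IsGL := by
  refine ⟨h.1, ?_⟩
  have : IsTrans F.W fun x y => F.rel y x := ⟨fun x y z h₁ h₂ => h.1 _ _ _ h₂ h₁⟩
  have : Std.Irrefl fun x y => F.rel y x := ⟨h.2⟩
  exact Finite.wellFounded_of_trans_of_irrefl _

theorem IsGL.irrefl {F : DynamicFrame.{u}} (h : F.IsGL) (x : F.W) : ¬ F.rel x x :=
  fun hx => h.2.asymmetric x x hx hx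

theorem IsK4.isWK4 {F : DynamicFrame.{u}} (h : F.IsK4) : F.IsWK4 :=
  fun x y z h₁ h₂ => .inr (h x y z h₁ h₂)

/-- The topological space of the upward closed sets of a frame. -/
@[reducible] def upTopology (F : DynamicFrame.{u}) : TopologicalSpace F.W where
  IsOpen U := ∀ x ∈ U, ∀ y, F.rel x y → y ∈ U
  isOpen_univ _ _ _ _ := trivial
  isOpen_inter _ _ h₁ h₂ x hx y hy := ⟨h₁ x hx.1 y hy, h₂ x hx.2 y hy⟩
  isOpen_sUnion _ h x hx y hy := by
    obtain ⟨U, hU, hxU⟩ := hx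
    exact ⟨U, hU, h U hU x hxU y hy⟩

/-- The dynamic topological system of a dynamic frame. -/
def toDTS (F : DynamicFrame.{u}) : DTS.{u} :=
  letI := F.upTopology
  { X := F.W
    map := F.map
    continuous_map := by
      refine ⟨fun U hU x hx y hy => ?_⟩
      rcases F.weaklyMonotonic x y hy with h | h
      · exact show F.map y ∈ U from h ▸ hx
      · exact hU _ hx _ h }

theorem isOpen_toDTS {F : DynamicFrame.{u}} {U : Set F.toDTS.X} :
    IsOpen U ↔ ∀ x ∈ U, ∀ y, F.rel x y → y ∈ U := Iff.rfl

/-- By weak transitivity, x together with its successors is the least open neighbourhood of x; by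
irreflexivity, removing x leaves exactly the successors. -/
theorem coderivative_toDTS {F : DynamicFrame.{u}} (hF : F.IsWK4) (hirr : ∀ x, ¬ F.rel x x) :
    F.toDTS.coderivative = F.kripkeBox := by
  ext A x
  rw [DTS.mem_coderivative]
  constructor
  · rintro ⟨U, hU, hx, h⟩ y hy
    exact h y (isOpen_toDTS.1 hU x hx y hy) fun h => hirr x (h ▸ hy)
  · intro h
    refine ⟨insert x {y | F.rel x y}, isOpen_toDTS.2 ?_, mem_insert _ _,
      fun y hy hyx => h y (hy.resolve_left hyx)⟩
    rintro y (rfl | hy) z hz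
    · exact .inr hz
    · exact (hF x y z hy hz).imp_left Eq.symm

theorem not_valid_toDTS {PV : Type*} {F : DynamicFrame.{u}} (hF : F.IsWK4)
    (hirr : ∀ x, ¬ F.rel x x) {φ : Formula PV} (h : ¬ F.Valid φ) : ¬ F.toDTS.Valid φ := by
  refine fun h' => h fun V => ?_
  rw [← coderivative_toDTS hF hirr]
  exact h' V

theorem IsInvertible.toDTS {F : DynamicFrame.{u}} (h : F.IsInvertible) :
    F.toDTS.IsInvertible := by
  refine ⟨F.toDTS.continuous_map, fun U hU => isOpen_toDTS.2 ?_, h.1⟩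
  rintro _ ⟨x, hx, rfl⟩ y hy
  obtain ⟨y, rfl⟩ := h.1.2 y
  exact ⟨y, isOpen_toDTS.1 hU x hx y ((h.2 x y).2 hy), rfl⟩

/-- The successors of x form an open set, and so do x and its successors together; {x} is their
difference. -/
theorem IsK4.isTD_toDTS {F : DynamicFrame.{u}} (h : F.IsK4) (hirr : ∀ x, ¬ F.rel x x) :
    F.toDTS.IsTD := by
  intro x
  refine ⟨insert x {y | F.rel x y}, {y | F.rel x y}ᶜ, isOpen_toDTS.2 ?_, ⟨isOpen_toDTS.2 ?_⟩, ?_⟩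
  · rintro y (rfl | hy) z hz
    · exact .inr hz
    · exact .inr (h x y z hy hz)
  · rw [compl_compl]
    exact fun y hy z hz => h x y z hy hz
  · ext y
    constructor
    · rintro rfl
      exact ⟨.inl rfl, hirr y⟩
    · rintro ⟨hy | hy, hy'⟩
      · exact hy
      · exact absurd hy hy'

theorem IsGL.isScattered_toDTS {F : DynamicFrame.{u}} (h : F.IsGL) : F.toDTS.IsScattered := by
  intro A hA
  by_contra hne
  -- A point of A without successors in A is not a limit point of A.
  obtain ⟨x, hx, hmin⟩ := h.2.has_min A (nonempty_iff_ne_empty.2 hne)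
  have hx' : x ∉ F.toDTS.coderivative Aᶜ := fun h => DTS.mem_coderivative_compl.1 h (hA hx)
  rw [coderivative_toDTS h.1.isWK4 h.irrefl] at hx'
  exact hx' fun y hy hyA => hmin y hyA hy

open scoped Classical in
/-- The frame in which every reflexive point is replaced by two irreflexive points that see each
other. -/
noncomputable def split (F : DynamicFrame.{u}) : DynamicFrame.{u} where
  W := {x : F.W × Bool // F.rel x.1 x.1 ∨ x.2 = false}
  rel x y := F.rel x.1.1 y.1.1 ∧ x ≠ y
  -- A reflexive image keeps the index, so that an invertible map stays injective on the two copies;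
  -- an irreflexive image has only the copy `false`.
  map x := ⟨(F.map x.1.1, if F.rel (F.map x.1.1) (F.map x.1.1) then x.1.2 else false),
    by by_cases h : F.rel (F.map x.1.1) (F.map x.1.1) <;> simp [h]⟩
  weaklyMonotonic := by
    rintro ⟨⟨w, i⟩, hw⟩ ⟨⟨v, j⟩, hv⟩ ⟨h, -⟩
    refine or_iff_not_imp_left.2 fun hne => ⟨?_, hne⟩
    rcases F.weaklyMonotonic w v h with h' | h'
    · by_cases hr : F.rel (F.map w) (F.map w)
      · show F.rel (F.map w) (F.map v)
        rwa [← h']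
      · have hr' : ¬ F.rel (F.map v) (F.map v) := h' ▸ hr
        exact absurd (Subtype.ext (Prod.ext h' (by simp [hr, hr']))) hne
    · exact h'

theorem finite_split {F : DynamicFrame.{u}} (hF : Finite F.W) : Finite F.split.W :=
  inferInstanceAs (Finite {x : F.W × Bool // F.rel x.1 x.1 ∨ x.2 = false})

theorem irrefl_split (F : DynamicFrame.{u}) (x : F.split.W) : ¬ F.split.rel x x :=
  fun h => h.2 rfl

theorem IsWK4.split {F : DynamicFrame.{u}} (h : F.IsWK4) : F.split.IsWK4 := by
  rintro ⟨⟨w, i⟩, hw⟩ ⟨⟨v, j⟩, hv⟩ ⟨⟨u, k⟩, hu⟩ ⟨h₁, -⟩ ⟨h₂, -⟩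
  refine or_iff_not_imp_left.2 fun hne => ⟨?_, hne⟩
  rcases h w v u h₁ h₂ with rfl | h'
  · by_contra hr
    have hi := hw.resolve_left hr
    have hk := hu.resolve_left hr
    exact hne (Subtype.ext (Prod.ext rfl (hi.trans hk.symm)))
  · exact h'

/-- An automorphism preserves reflexivity, so the index of a copy of a reflexive point can be
recovered from its image. -/
theorem IsInvertible.split {F : DynamicFrame.{u}} (hF : Finite F.W) (h : F.IsInvertible) :
    F.split.IsInvertible := by
  have hinj : Function.Injective F.split.map := by
    rintro ⟨⟨w, i⟩, hw⟩ ⟨⟨v, j⟩, hv⟩ heq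
    have h₁ : F.map w = F.map v := congrArg (fun x => x.1.1) heq
    obtain rfl := h.1.1 h₁
    have h₂ := congrArg (fun x => x.1.2) heq
    by_cases hr : F.rel w w
    · have hr' := (h.2 w w).1 hr
      simp only [DynamicFrame.split, if_pos hr'] at h₂
      exact Subtype.ext (Prod.ext rfl h₂)
    · exact Subtype.ext (Prod.ext rfl ((hw.resolve_left hr).trans (hv.resolve_left hr).symm))
  have := finite_split hF
  exact ⟨⟨hinj, Finite.surjective_of_injective hinj⟩,
    fun x y => and_congr (h.2 _ _) hinj.ne_iff.symm⟩

theorem not_valid_split {PV : Type*} {F : DynamicFrame.{u}} {φ : Formula PV}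
    (h : ¬ F.Valid φ) : ¬ F.split.Valid φ := by
  refine not_valid_of_pMorphism (F' := F.split) (fun x => x.1.1)
    (fun w => ⟨⟨(w, false), .inr rfl⟩, rfl⟩) (fun _ => rfl) (fun _ _ h => h.1) ?_ h
  rintro ⟨⟨w, i⟩, hw⟩ v hv
  change F.rel w v at hv
  -- A reflexive point sees itself by way of its other copy.
  by_cases hwv : w = v
  · subst hwv
    exact ⟨⟨(w, !i), .inl hv⟩, ⟨hv, fun h => by
      have := congrArg (fun x => x.1.2) h
      simp at this⟩, rfl⟩
  · exact ⟨⟨(v, false), .inr rfl⟩, ⟨hv, fun h => hwv (congrArg (fun x => x.1.1) h)⟩, rfl⟩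

theorem not_valid_pathFrame {PV : Type*} {F : DynamicFrame.{u}} (hF : F.IsK4) {φ : Formula PV}
    (h : ¬ F.Valid φ) : ¬ (pathFrame F hF).Valid φ :=
  not_valid_of_pMorphism (F' := pathFrame F hF) Path.last
    (fun w => ⟨Path.single F.rel w, rfl⟩) (Path.last_map hF F.weaklyMonotonic)
    (fun _ _ => Path.rel_last) (fun p _ => p.exists_rel_last_eq hF) h

/-- The product of an invertible frame with the natural numbers in their strict order. -/
def prodNat (F : DynamicFrame.{u}) (h : F.IsInvertible) : DynamicFrame.{u} where
  W := F.W × ℕ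
  rel x y := F.rel x.1 y.1 ∧ x.2 < y.2
  map x := (F.map x.1, x.2)
  weaklyMonotonic _ _ hr := .inr ⟨(h.2 _ _).1 hr.1, hr.2⟩

theorem IsK4.prodNat {F : DynamicFrame.{u}} (hF : F.IsK4) (h : F.IsInvertible) :
    (F.prodNat h).IsK4 :=
  fun x y z h₁ h₂ => ⟨hF x.1 y.1 z.1 h₁.1 h₂.1, h₁.2.trans h₂.2⟩

theorem irrefl_prodNat {F : DynamicFrame.{u}} (h : F.IsInvertible) (x : F.W × ℕ) :
    ¬ (F.prodNat h).rel x x :=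
  fun h => lt_irrefl _ h.2

theorem isInvertible_prodNat {F : DynamicFrame.{u}} (h : F.IsInvertible) :
    (F.prodNat h).IsInvertible :=
  ⟨h.1.prodMap Function.bijective_id, fun _ _ => and_congr_left fun _ => h.2 _ _⟩

/-- Reflexive points unfold into ascending copies. Paths would not serve here: for reflexive w,
`collapse` sends [w] and [w, w] to the same list, so the induced map is not injective. -/
theorem not_valid_prodNat {PV : Type*} {F : DynamicFrame.{u}} (h : F.IsInvertible)
    {φ : Formula PV} (hφ : ¬ F.Valid φ) : ¬ (F.prodNat h).Valid φ :=
  not_valid_of_pMorphism (F' := F.prodNat h) Prod.fst (fun w => ⟨(w, 0), rfl⟩) (fun _ => rfl)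
    (fun _ _ h => h.1) (fun x z hz => ⟨(z, x.2 + 1), ⟨hz, Nat.lt_succ_self _⟩, rfl⟩) hφ

end DynamicFrame

/-! ### Completeness -/

section Completeness

variable {PV : Type u} {Ax : Set (Formula PV)} {φ : Formula PV}

theorem not_valid_of_not_mem_truth {F : DynamicFrame.{v}} {V : PV → Set F.W} {x : F.W}
    (h : x ∉ F.truth V φ) : ¬ F.Valid φ := by
  intro h'
  rw [DynamicFrame.truth, h'] at h
  exact h trivial

theorem exists_finite_frame_of_axiomC {K : ∀ W : Type u, (W → W → Prop) → Prop}
    (hK : HasFiniteQuotients K) (hK' : IsAdditiveClass K) (hC : axiomC PV ⊆ Ax)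
    (hrel : K (World Ax) World.rel) (hφ : ¬ Derivable Ax φ) :
    ∃ F : DynamicFrame.{u}, Finite F.W ∧ K F.W F.rel ∧ ¬ F.Valid φ := by
  obtain ⟨w, hw⟩ := exists_world_not_mem hφ
  obtain ⟨Γ, hfin, hΓ, hφΓ⟩ := exists_finite_subformulaClosed φ
  obtain ⟨D, V, π, hD, hKD, -, htruth⟩ := DynamicFrame.exists_finite_layers hK hK'
    (M := canonicalFrame Ax fun _ _ => World.map_weaklyMonotonic hC) hrel
    (canonicalValuation Ax) hfin hΓ (φ.nextDepth + 1)
  refine ⟨D, hD, hKD, not_valid_of_not_mem_truth (V := V) (x := π w) ?_⟩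
  exact fun h => hw ((mem_truthSet_canonical φ w).1 ((htruth φ hφΓ (Nat.lt_succ_self _) _).1 h))

theorem loebSet_canonical (hL : axiomL PV ⊆ Ax) (ψ : Formula PV) :
    LoebSet World.rel {w : World Ax | ψ ∈ w} := by
  rintro w ⟨v, hv, hψ⟩
  obtain ⟨v, hv, h₁, h₂⟩ := World.exists_rel_of_loeb hL (w := w) fun h => hψ (hv ψ h)
  exact ⟨v, hv, h₁, fun u hu => hu ψ h₂⟩

theorem exists_finite_frame_of_axiomL_of_axiomC (h4 : axiom4 PV ⊆ Ax) (hL : axiomL PV ⊆ Ax)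
    (hC : axiomC PV ⊆ Ax) (hφ : ¬ Derivable Ax φ) :
    ∃ F : DynamicFrame.{u}, Finite F.W ∧ IsStrictOrderRel F.W F.rel ∧ ¬ F.Valid φ := by
  obtain ⟨w, hw⟩ := exists_world_not_mem hφ
  obtain ⟨Γ, hfin, hΓ, hφΓ⟩ := exists_finite_subformulaClosed φ
  have hmono : ∀ w v : World Ax, w.rel v → w.map = v.map ∨ w.map.rel v.map :=
    fun _ _ => World.map_weaklyMonotonic hC
  obtain ⟨D, V, j, hD, hKD, -, htruth⟩ := DynamicFrame.exists_finite_layers_of_loeb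
    (M := canonicalFrame Ax hmono) (fun _ _ _ => World.rel_trans h4)
    (canonicalValuation Ax) hfin hΓ (fun ψ _ => by
      have : (canonicalFrame Ax hmono).truth (canonicalValuation Ax) ψ =
        {w : World Ax | ψ ∈ w} := ext fun w => mem_truthSet_canonical ψ w
      rw [this]
      exact loebSet_canonical hL ψ) (φ.nextDepth + 1)
    (finite_singleton (Path.single _ w))
  refine ⟨D, hD, hKD, not_valid_of_not_mem_truth (V := V) (x := j ⟨_, rfl⟩) ?_⟩
  exact fun h => hw ((mem_truthSet_canonical φ w).1 ((htruth φ hφΓ (Nat.lt_succ_self _) _).1 h))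

theorem mem_iterate_map {w : World Ax} {n : ℕ} :
    φ ∈ World.map^[n] w ↔ Formula.next^[n] φ ∈ w := by
  induction n generalizing w φ with
  | zero => rfl
  | succ n ih =>
    rw [Function.iterate_succ_apply, Function.iterate_succ_apply', ih]
    rfl

theorem exists_finite_frame_of_axiomH [Nonempty PV]
    {K : ∀ W : Type u, (W → W → Prop) → Prop} (hH : axiomH PV ⊆ Ax)
    (hsel : ∀ Δ : Set (Formula PV), Δ.Finite → ∀ w : World Ax,
      ∃ (Q : Type u) (r : Q → Q → Prop) (l : Q → World Ax) (q₀ : Q), Finite Q ∧ K Q r ∧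
      (∀ ψ ∈ Δ, ψ ∈ l q₀ ↔ ψ ∈ w) ∧
      ∀ ψ ∈ Δ, ∀ q, (∀ v, (l q).rel v → ψ ∈ v) ↔ ∀ q', r q q' → ψ ∈ l q')
    (hφ : ¬ Derivable Ax φ) :
    ∃ (Q : Type u) (r : Q → Q → Prop) (n : ℕ), Finite Q ∧ K Q r ∧
      ¬ (DynamicFrame.cyclic r n).Valid φ := by
  obtain ⟨w, hw⟩ := exists_world_not_mem hφ
  obtain ⟨Γ, hfin, hΓ, hφΓ⟩ := exists_finite_subformulaClosed φ
  have hmono : ∀ w v : World Ax, w.rel v → w.map = v.map ∨ w.map.rel v.map :=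
    fun _ _ h => .inr (World.map_rel_map hH h)
  have htruth : ∀ ψ (w : World Ax), w ∈ (canonicalFrame Ax hmono).truth
      (canonicalValuation Ax) ψ ↔ ψ ∈ w := mem_truthSet_canonical
  let n := φ.nextDepth
  -- The truth of ○^i ψ at a world is the truth of ψ at its i-fold image, so the selection must
  -- respect these formulas for i ≤ n.
  obtain ⟨Q, r, l, q₀, hQ, hKr, hq₀, hbox⟩ :=
    hsel (image2 (fun i ψ => Formula.next^[i] ψ) (Iic n) Γ) ((finite_Iic n).image2 _ hfin) w
  have hφn : φ ∈ image2 (fun i ψ => Formula.next^[i] ψ) (Iic n) Γ :=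
    ⟨0, Nat.zero_le _, φ, hφΓ, rfl⟩
  refine ⟨Q, r, n, hQ, hKr, not_valid_of_not_mem_truth (F := DynamicFrame.cyclic r n)
    (V := _) (x := ((q₀, 0) : Q × Fin (n + 1))) (mt (DynamicFrame.mem_truth_cyclic
    (M := canonicalFrame Ax hmono) (VM := canonicalValuation Ax) (l := l) hΓ
    (fun _ _ => World.map_rel_map hH) (fun _ _ => World.exists_map_eq hH) ?_ hφΓ q₀ 0
    (by simp [n])).1 fun h => hw ((hq₀ φ hφn).1 ((htruth _ _).1 h)))⟩
  intro ψ hψ i hi q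
  have h₁ : ∀ v : World Ax, (canonicalFrame Ax hmono).map^[i] v ∈
      (canonicalFrame Ax hmono).truth (canonicalValuation Ax) ψ ↔ Formula.next^[i] ψ ∈ v :=
    fun v => (htruth _ _).trans mem_iterate_map
  exact (forall_congr' fun v => imp_congr_right fun _ => h₁ v).trans
    ((hbox _ ⟨i, hi, ψ, hψ, rfl⟩ q).trans
      (forall_congr' fun q' => imp_congr_right fun _ => (h₁ (l q')).symm))

theorem HasFiniteQuotients.exists_world_selection
    {K : ∀ W : Type u, (W → W → Prop) → Prop} (hK : HasFiniteQuotients K)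
    (hrel : K (World Ax) World.rel) (Δ : Set (Formula PV)) (hΔ : Δ.Finite) (w : World Ax) :
      ∃ (Q : Type u) (r : Q → Q → Prop) (l : Q → World Ax) (q₀ : Q), Finite Q ∧ K Q r ∧
      (∀ ψ ∈ Δ, ψ ∈ l q₀ ↔ ψ ∈ w) ∧
      ∀ ψ ∈ Δ, ∀ q, (∀ v, (l q).rel v → ψ ∈ v) ↔ ∀ q', r q q' → ψ ∈ l q' := by
  obtain ⟨Q, r, l, q₀, hQ, hKr, h₁, h₂⟩ :=
    hK.exists_selection hrel (hΔ.image fun ψ => {w : World Ax | ψ ∈ w}) w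
  exact ⟨Q, r, l, q₀, hQ, hKr, fun ψ hψ => h₁ _ (mem_image_of_mem _ hψ),
    fun ψ hψ => h₂ _ (mem_image_of_mem _ hψ)⟩

theorem exists_world_selection_of_loeb (h4 : axiom4 PV ⊆ Ax) (hL : axiomL PV ⊆ Ax)
    (Δ : Set (Formula PV)) (hΔ : Δ.Finite) (w : World Ax) :
      ∃ (Q : Type u) (r : Q → Q → Prop) (l : Q → World Ax) (q₀ : Q), Finite Q ∧
      IsStrictOrderRel Q r ∧ (∀ ψ ∈ Δ, ψ ∈ l q₀ ↔ ψ ∈ w) ∧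
      ∀ ψ ∈ Δ, ∀ q, (∀ v, (l q).rel v → ψ ∈ v) ↔ ∀ q', r q q' → ψ ∈ l q' := by
  obtain ⟨Q, r, l, q₀, hQ, hKr, h₁, h₂⟩ := exists_selection_of_loeb
    (R := World.rel (Ax := Ax)) (fun _ _ _ => World.rel_trans h4)
    (hΔ.image fun ψ => {w : World Ax | ψ ∈ w})
    (by rintro _ ⟨ψ, -, rfl⟩; exact loebSet_canonical hL ψ) w
  exact ⟨Q, r, l, q₀, hQ, hKr, fun ψ hψ => h₁ _ (mem_image_of_mem _ hψ),
    fun ψ hψ => h₂ _ (mem_image_of_mem _ hψ)⟩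

theorem isWK4_cyclic {Q : Type u} {r : Q → Q → Prop} (h : IsWeaklyTransitiveRel Q r) (n : ℕ) :
    (DynamicFrame.cyclic r n).IsWK4 :=
  fun x y z h₁ h₂ => (h x.1 y.1 z.1 h₁.1 h₂.1).imp
    (fun h => Prod.ext h (h₁.2.trans h₂.2)) fun h => ⟨h, h₁.2.trans h₂.2⟩

theorem isK4_cyclic {Q : Type u} {r : Q → Q → Prop} (h : IsTransitiveRel Q r) (n : ℕ) :
    (DynamicFrame.cyclic r n).IsK4 :=
  fun x y z h₁ h₂ => ⟨h x.1 y.1 z.1 h₁.1 h₂.1, h₁.2.trans h₂.2⟩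

theorem finite_cyclic {Q : Type u} (r : Q → Q → Prop) [Finite Q] (n : ℕ) :
    Finite (DynamicFrame.cyclic r n).W :=
  inferInstanceAs (Finite (Q × Fin (n + 1)))

theorem isGL_cyclic {Q : Type u} {r : Q → Q → Prop} [Finite Q] (h : IsStrictOrderRel Q r)
    (n : ℕ) : (DynamicFrame.cyclic r n).IsGL :=
  DynamicFrame.isGL_of_isStrictOrderRel (finite_cyclic r n)
    ⟨isK4_cyclic h.1 n, fun x hx => h.2 x.1 hx.1⟩

end Completeness

/-! ### Soundness and completeness of the six logics -/

section Logics

variable {PV : Type u}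

theorem FrameSoundComplete.hasFiniteKripkeModelProperty {L : Set (Formula PV)}
    {C : Set DynamicFrame.{v}} (h : FrameSoundComplete L C) (hC : ∀ F ∈ C, Finite F.W) :
    HasFiniteKripkeModelProperty.{u, v} L := by
  intro φ hφ
  by_contra! h'
  exact hφ (h.2 φ fun F hF => h' F (hC F hF) fun ψ hψ => h.1 ψ hψ F hF)

theorem FrameSoundComplete.topSoundComplete {L : Set (Formula PV)} {C : Set DynamicFrame.{v}}
    {C' : Set DTS.{v}} (h : FrameSoundComplete L C) (hs : ∀ φ ∈ L, ∀ S ∈ C', S.Valid φ)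
    (hC : ∀ F ∈ C, ∀ φ : Formula PV, ¬ F.Valid φ → ∃ S ∈ C', ¬ S.Valid φ) :
    TopSoundComplete L C' := by
  refine ⟨hs, fun φ hφ => h.2 φ fun F hF => ?_⟩
  by_contra h'
  obtain ⟨S, hS, hS'⟩ := hC F hF φ h'
  exact hS' (hφ S hS)

theorem DynamicFrame.valid_of_derivable {F : DynamicFrame.{v}} {Ax : Set (Formula PV)}
    (hAx : ∀ χ ∈ Ax, ∀ V x, x ∈ F.truth V χ) {φ : Formula PV} (h : Derivable Ax φ) :
    F.Valid φ :=
  fun V => eq_univ_of_forall fun x =>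
    h.sound F.isNormalOperator_kripkeBox (fun χ hχ => hAx χ hχ V) x

theorem DTS.valid_of_derivable {S : DTS.{v}} {Ax : Set (Formula PV)}
    (hAx : ∀ χ ∈ Ax, ∀ V x, x ∈ truthSet S.coderivative S.map V χ) {φ : Formula PV}
    (h : Derivable Ax φ) : S.Valid φ :=
  fun V => eq_univ_of_forall fun x =>
    h.sound S.isNormalOperator_coderivative (fun χ hχ => hAx χ hχ V) x

theorem frameSoundComplete_wK4C :
    FrameSoundComplete (wK4C PV) {F : DynamicFrame.{v} | Finite F.W ∧ F.IsWK4} := by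
  refine ⟨fun φ hφ F hF => F.valid_of_derivable ?_ hφ, fun φ hφ => by_contra fun h => ?_⟩
  · rintro χ (h | h) V
    · exact sound_axiomW4 hF.2.kripkeBox χ h
    · exact sound_axiomC F.kripkeBox_C χ h
  · obtain ⟨F, hF, hK, hv⟩ := exists_finite_frame_of_axiomC hasFiniteQuotients_weaklyTransitive
      isAdditiveClass_weaklyTransitive subset_union_right
      (fun _ _ _ => World.rel_weaklyTransitive subset_union_left) h
    obtain ⟨F', hF', h₁, -, -, -, hv'⟩ := DynamicFrame.exists_finite_copy hF hv
    exact hv' (hφ F' ⟨hF', h₁ hK⟩)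

theorem frameSoundComplete_K4C :
    FrameSoundComplete (K4C PV) {F : DynamicFrame.{v} | Finite F.W ∧ F.IsK4} := by
  refine ⟨fun φ hφ F hF => F.valid_of_derivable ?_ hφ, fun φ hφ => by_contra fun h => ?_⟩
  · rintro χ (h | h) V
    · exact sound_axiom4 hF.2.kripkeBox χ h
    · exact sound_axiomC F.kripkeBox_C χ h
  · obtain ⟨F, hF, hK, hv⟩ := exists_finite_frame_of_axiomC hasFiniteQuotients_transitive
      isAdditiveClass_transitive subset_union_right
      (fun _ _ _ => World.rel_trans subset_union_left) h
    obtain ⟨F', hF', -, h₁, -, -, hv'⟩ := DynamicFrame.exists_finite_copy hF hv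
    exact hv' (hφ F' ⟨hF', h₁ hK⟩)

theorem frameSoundComplete_GLC :
    FrameSoundComplete (GLC PV) {F : DynamicFrame.{v} | Finite F.W ∧ F.IsGL} := by
  refine ⟨fun φ hφ F hF => F.valid_of_derivable ?_ hφ, fun φ hφ => by_contra fun h => ?_⟩
  · rintro χ ((h | h) | h) V
    · exact sound_axiom4 hF.2.1.kripkeBox χ h
    · exact sound_axiomL F.isNormalOperator_kripkeBox hF.2.kripkeBox χ h
    · exact sound_axiomC F.kripkeBox_C χ h
  · obtain ⟨F, hF, hK, hv⟩ := exists_finite_frame_of_axiomL_of_axiomC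
      (subset_union_left.trans subset_union_left) (subset_union_right.trans subset_union_left)
      subset_union_right h
    obtain ⟨F', hF', -, -, h₁, -, hv'⟩ := DynamicFrame.exists_finite_copy hF hv
    exact hv' (hφ F' ⟨hF', h₁ (DynamicFrame.isGL_of_isStrictOrderRel hF hK)⟩)

theorem frameSoundComplete_wK4H [Nonempty PV] : FrameSoundComplete (wK4H PV)
    {F : DynamicFrame.{v} | Finite F.W ∧ F.IsWK4 ∧ F.IsInvertible} := by
  refine ⟨fun φ hφ F hF => F.valid_of_derivable ?_ hφ, fun φ hφ => by_contra fun h => ?_⟩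
  · rintro χ (h | h) V
    · exact sound_axiomW4 hF.2.1.kripkeBox χ h
    · exact sound_axiomH hF.2.2.kripkeBox χ h
  · obtain ⟨Q, r, n, hQ, hK, hv⟩ := exists_finite_frame_of_axiomH subset_union_right
      (hasFiniteQuotients_weaklyTransitive.exists_world_selection
        (fun _ _ _ => World.rel_weaklyTransitive subset_union_left)) h
    obtain ⟨F', hF', h₁, -, -, h₂, hv'⟩ := DynamicFrame.exists_finite_copy (finite_cyclic r n) hv
    exact hv' (hφ F' ⟨hF', h₁ (isWK4_cyclic hK n), h₂ (DynamicFrame.isInvertible_cyclic r n)⟩)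

theorem frameSoundComplete_K4H [Nonempty PV] : FrameSoundComplete (K4H PV)
    {F : DynamicFrame.{v} | Finite F.W ∧ F.IsK4 ∧ F.IsInvertible} := by
  refine ⟨fun φ hφ F hF => F.valid_of_derivable ?_ hφ, fun φ hφ => by_contra fun h => ?_⟩
  · rintro χ (h | h) V
    · exact sound_axiom4 hF.2.1.kripkeBox χ h
    · exact sound_axiomH hF.2.2.kripkeBox χ h
  · obtain ⟨Q, r, n, hQ, hK, hv⟩ := exists_finite_frame_of_axiomH subset_union_right
      (hasFiniteQuotients_transitive.exists_world_selection
        (fun _ _ _ => World.rel_trans subset_union_left)) h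
    obtain ⟨F', hF', -, h₁, -, h₂, hv'⟩ := DynamicFrame.exists_finite_copy (finite_cyclic r n) hv
    exact hv' (hφ F' ⟨hF', h₁ (isK4_cyclic hK n), h₂ (DynamicFrame.isInvertible_cyclic r n)⟩)

theorem frameSoundComplete_GLH [Nonempty PV] : FrameSoundComplete (GLH PV)
    {F : DynamicFrame.{v} | Finite F.W ∧ F.IsGL ∧ F.IsInvertible} := by
  refine ⟨fun φ hφ F hF => F.valid_of_derivable ?_ hφ, fun φ hφ => by_contra fun h => ?_⟩
  · rintro χ ((h | h) | h) V
    · exact sound_axiom4 hF.2.1.1.kripkeBox χ h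
    · exact sound_axiomL F.isNormalOperator_kripkeBox hF.2.1.kripkeBox χ h
    · exact sound_axiomH hF.2.2.kripkeBox χ h
  · obtain ⟨Q, r, n, hQ, hK, hv⟩ := exists_finite_frame_of_axiomH subset_union_right
      (exists_world_selection_of_loeb (subset_union_left.trans subset_union_left)
        (subset_union_right.trans subset_union_left)) h
    obtain ⟨F', hF', -, -, h₁, h₂, hv'⟩ := DynamicFrame.exists_finite_copy (finite_cyclic r n) hv
    exact hv' (hφ F' ⟨hF', h₁ (isGL_cyclic hK n), h₂ (DynamicFrame.isInvertible_cyclic r n)⟩)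

theorem topSoundComplete_wK4C : TopSoundComplete (wK4C PV) {S : DTS.{v} | Finite S.X} := by
  refine frameSoundComplete_wK4C.topSoundComplete
    (fun φ hφ S hS => S.valid_of_derivable ?_ hφ) ?_
  · rintro χ (h | h) V
    · exact sound_axiomW4 S.coderivative_w4 χ h
    · exact sound_axiomC S.coderivative_C χ h
  · exact fun F hF φ hφ => ⟨F.split.toDTS, DynamicFrame.finite_split hF.1,
      DynamicFrame.not_valid_toDTS hF.2.split F.irrefl_split (DynamicFrame.not_valid_split hφ)⟩

/-- The systems have to be infinite in general: a finite T_D space is scattered and would validate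
L. -/
theorem topSoundComplete_K4C : TopSoundComplete (K4C PV) {S : DTS.{v} | S.IsTD} := by
  refine frameSoundComplete_K4C.topSoundComplete
    (fun φ hφ S hS => S.valid_of_derivable ?_ hφ) ?_
  · rintro χ (h | h) V
    · exact sound_axiom4 (DTS.IsTD.coderivative hS) χ h
    · exact sound_axiomC S.coderivative_C χ h
  · intro F hF φ hφ
    have hK4 : (pathFrame F hF.2).IsK4 := Path.isStrictOrderRel_rel.1
    exact ⟨(pathFrame F hF.2).toDTS, hK4.isTD_toDTS Path.isStrictOrderRel_rel.2,
      DynamicFrame.not_valid_toDTS hK4.isWK4 Path.isStrictOrderRel_rel.2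
        (DynamicFrame.not_valid_pathFrame hF.2 hφ)⟩

theorem topSoundComplete_GLC :
    TopSoundComplete (GLC PV) {S : DTS.{v} | Finite S.X ∧ S.IsScattered} := by
  refine frameSoundComplete_GLC.topSoundComplete
    (fun φ hφ S hS => S.valid_of_derivable ?_ hφ) ?_
  · rintro χ ((h | h) | h) V
    · exact sound_axiom4 (S.isNormalOperator_coderivative.four_of_loeb hS.2.coderivative) χ h
    · exact sound_axiomL S.isNormalOperator_coderivative hS.2.coderivative χ h
    · exact sound_axiomC S.coderivative_C χ h
  · exact fun F hF φ hφ => ⟨F.toDTS, ⟨hF.1, hF.2.isScattered_toDTS⟩,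
      DynamicFrame.not_valid_toDTS hF.2.1.isWK4 hF.2.irrefl hφ⟩

theorem topSoundComplete_wK4H [Nonempty PV] :
    TopSoundComplete (wK4H PV) {S : DTS.{v} | Finite S.X ∧ S.IsInvertible} := by
  refine frameSoundComplete_wK4H.topSoundComplete
    (fun φ hφ S hS => S.valid_of_derivable ?_ hφ) ?_
  · rintro χ (h | h) V
    · exact sound_axiomW4 S.coderivative_w4 χ h
    · exact sound_axiomH hS.2.coderivative χ h
  · exact fun F hF φ hφ => ⟨F.split.toDTS,
      ⟨DynamicFrame.finite_split hF.1, (hF.2.2.split hF.1).toDTS⟩,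
      DynamicFrame.not_valid_toDTS hF.2.1.split F.irrefl_split
        (DynamicFrame.not_valid_split hφ)⟩

theorem topSoundComplete_K4H [Nonempty PV] :
    TopSoundComplete (K4H PV) {S : DTS.{v} | S.IsTD ∧ S.IsInvertible} := by
  refine frameSoundComplete_K4H.topSoundComplete
    (fun φ hφ S hS => S.valid_of_derivable ?_ hφ) ?_
  · rintro χ (h | h) V
    · exact sound_axiom4 hS.1.coderivative χ h
    · exact sound_axiomH hS.2.coderivative χ h
  · intro F hF φ hφ
    have hK4 := hF.2.1.prodNat hF.2.2
    have hirr := DynamicFrame.irrefl_prodNat hF.2.2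
    exact ⟨(F.prodNat hF.2.2).toDTS,
      ⟨hK4.isTD_toDTS hirr, (DynamicFrame.isInvertible_prodNat hF.2.2).toDTS⟩,
      DynamicFrame.not_valid_toDTS hK4.isWK4 hirr (DynamicFrame.not_valid_prodNat hF.2.2 hφ)⟩

theorem topSoundComplete_GLH [Nonempty PV] :
    TopSoundComplete (GLH PV)
      {S : DTS.{v} | Finite S.X ∧ S.IsScattered ∧ S.IsInvertible} := by
  refine frameSoundComplete_GLH.topSoundComplete
    (fun φ hφ S hS => S.valid_of_derivable ?_ hφ) ?_
  · rintro χ ((h | h) | h) V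
    · exact sound_axiom4 (S.isNormalOperator_coderivative.four_of_loeb hS.2.1.coderivative) χ h
    · exact sound_axiomL S.isNormalOperator_coderivative hS.2.1.coderivative χ h
    · exact sound_axiomH hS.2.2.coderivative χ h
  · exact fun F hF φ hφ => ⟨F.toDTS, ⟨hF.1, hF.2.1.isScattered_toDTS, hF.2.2.toDTS⟩,
      DynamicFrame.not_valid_toDTS hF.2.1.1.isWK4 hF.2.1.irrefl hφ⟩

end Logics

end CantorDynamic

theorem mainTheorem2 (PV : Type u) [Nonempty PV] :
    -- the logics with axiom `C`
    (FrameSoundComplete (wK4C PV) {F : DynamicFrame.{v} | Finite F.W ∧ F.IsWK4} ∧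
      TopSoundComplete (wK4C PV) {S : DTS.{v} | Finite S.X}) ∧
    (FrameSoundComplete (K4C PV) {F : DynamicFrame.{v} | Finite F.W ∧ F.IsK4} ∧
      TopSoundComplete (K4C PV) {S : DTS.{v} | S.IsTD}) ∧
    (FrameSoundComplete (GLC PV) {F : DynamicFrame.{v} | Finite F.W ∧ F.IsGL} ∧
      TopSoundComplete (GLC PV) {S : DTS.{v} | Finite S.X ∧ S.IsScattered}) ∧
    -- the logics with axiom `H`
    (FrameSoundComplete (wK4H PV)
        {F : DynamicFrame.{v} | Finite F.W ∧ F.IsWK4 ∧ F.IsInvertible} ∧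
      TopSoundComplete (wK4H PV) {S : DTS.{v} | Finite S.X ∧ S.IsInvertible}) ∧
    (FrameSoundComplete (K4H PV)
        {F : DynamicFrame.{v} | Finite F.W ∧ F.IsK4 ∧ F.IsInvertible} ∧
      TopSoundComplete (K4H PV) {S : DTS.{v} | S.IsTD ∧ S.IsInvertible}) ∧
    (FrameSoundComplete (GLH PV)
        {F : DynamicFrame.{v} | Finite F.W ∧ F.IsGL ∧ F.IsInvertible} ∧
      TopSoundComplete (GLH PV)
        {S : DTS.{v} | Finite S.X ∧ S.IsScattered ∧ S.IsInvertible}) ∧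
    -- the finite Kripke model property
    (HasFiniteKripkeModelProperty.{u, v} (wK4C PV) ∧
      HasFiniteKripkeModelProperty.{u, v} (K4C PV) ∧
      HasFiniteKripkeModelProperty.{u, v} (GLC PV) ∧
      HasFiniteKripkeModelProperty.{u, v} (wK4H PV) ∧
      HasFiniteKripkeModelProperty.{u, v} (K4H PV) ∧
      HasFiniteKripkeModelProperty.{u, v} (GLH PV)) := by
  exact ⟨⟨frameSoundComplete_wK4C, topSoundComplete_wK4C⟩,
    ⟨frameSoundComplete_K4C, topSoundComplete_K4C⟩,
    ⟨frameSoundComplete_GLC, topSoundComplete_GLC⟩,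
    ⟨frameSoundComplete_wK4H, topSoundComplete_wK4H⟩,
    ⟨frameSoundComplete_K4H, topSoundComplete_K4H⟩,
    ⟨frameSoundComplete_GLH, topSoundComplete_GLH⟩,
    frameSoundComplete_wK4C.hasFiniteKripkeModelProperty fun _ h => h.1,
    frameSoundComplete_K4C.hasFiniteKripkeModelProperty fun _ h => h.1,
    frameSoundComplete_GLC.hasFiniteKripkeModelProperty fun _ h => h.1,
    frameSoundComplete_wK4H.hasFiniteKripkeModelProperty fun _ h => h.1,
    frameSoundComplete_K4H.hasFiniteKripkeModelProperty fun _ h => h.1,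
    frameSoundComplete_GLH.hasFiniteKripkeModelProperty fun _ h => h.1⟩
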